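/- \textbf{Setting.} All vector spaces are complex. Let $X$ be a Banach space and let $U$, $Y$ be Fréchet spaces (complete Hausdorff vector spaces topologized by a countable family of seminorms; in particular, Banach spaces are allowed). Let $B : U \to X$, $C : X \to Y$, $D : U \to Y$ be continuous linear operators, and let $A : \operatorname{Dom}(A) \subseteq X \to X$ be a linear operator that is \emph{sectorial}: $A$ is densely defined and there are $\omega \in \mathbb{R}$, $\theta > \pi/2$ and a constant $K$ such that every $z \in \omega + \{t e^{i\alpha} : t > 0,\ |\alpha| < \theta\}$ lies in the resolvent set of $A$ and $\|(z - A)^{-1}\| \le K/|z - \omega|$. Assume moreover that $A$ has \emph{compact resolvents}, i.e. $(z - A)^{-1}$ is compact for every $z$ in the resolvent set. Let $\mathcal{P}$ be the set of all pairs $(u, y)$ of functions $u \in C^\infty([0,\infty), U)$, $y \in C^\infty([0,\infty), Y)$ for which there is $x \in C^\infty([0,\infty), X)$ such that, for all $t \ge 0$, $x(t) \in \operatorname{Dom}(A)$, \[ \dot{x}(t) = A x(t) + B u(t), \qquad y(t) = C x(t) + D u(t). \] A function $f$ on $[0,\infty)$ \emph{vanishes} if $f(t) \to 0$ as $t \to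 \infty$; a smooth $f$ \emph{vanishes smoothly} if $f$ and all its derivatives vanish. $\mathcal{P}$ is \emph{stable} if $y$ vanishes whenever $(0, y) \in \mathcal{P}$; it is \emph{VIVO} (vanishing-input-vanishing-output) if $y$ vanishes whenever $(u, y) \in \mathcal{P}$ and $u$ vanishes; it is \emph{smoothly VIVO} if $y$ vanishes smoothly whenever $(u, y) \in \mathcal{P}$ and $u$ vanishes smoothly. \textbf{Theorem.} $A$ is the generator of a strongly continuous semigroup $(e^{At})_{t \ge 0}$ on $X$; the operator $e^{A}$ is compact; and the following are equivalent: \begin{enumerate} \item[(a)] $\mathcal{P}$ is stable. \item[(b)] Whenever $\lambda \in \mathbb{C}$ with $|\lambda| \ge 1$, $m \in \mathbb{N}$, and $\mu_1, \ldots, \mu_m \in \mathbb{C}$ satisfy $e^{\mu_j} = \lambda$ for all $j$, every $v_0$ in the domain of $(\mu_m - A) \cdots (\mu_1 - A)$ with $(\mu_m - A) \cdots (\mu_1 - A) v_0 = 0$ belongs to the unobservable subspace of $(e^{At}, C)$, i.e. to the largest subspace of $\ker C$ that is invariant under every $e^{At}$, $t \ge 0$. \item[(c)] $\mathcal{P}$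 is VIVO. \item[(d)] $\mathcal{P}$ is smoothly VIVO. \end{enumerate} -/

import Mathlib

open Set Filter Topology
open scoped NNReal

noncomputable section

/-! ### Fréchet spaces and smooth functions of nonnegative time -/

/-- A (complex) Fréchet space: a vector space topologized by a countable family of seminorms which
is complete and Hausdorff. -/
class FrechetSpace (E : Type*) [AddCommGroup E] [Module ℂ E] [UniformSpace E] : Prop
    extends IsUniformAddGroup E, T2Space E, CompleteSpace E where
  exists_withSeminorms : ∃ p : SeminormFamily ℂ E ℕ, WithSeminorms p

/-- Every complex Banach space is a Fréchet space. -/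
instance {E : Type*} [NormedAddCommGroup E] [NormedSpace ℂ E] [CompleteSpace E] :
    FrechetSpace E where
  exists_withSeminorms := by
    refine ⟨fun _ => normSeminorm ℂ E, ?_⟩
    have h := norm_withSeminorms ℂ E
    rw [SeminormFamily.withSeminorms_iff_topologicalSpace_eq_iInf] at h ⊢
    rw [h, ciInf_const, ciInf_const]

section Time

variable {E : Type*} [AddCommGroup E] [Module ℂ E] [TopologicalSpace E]

/-- The time derivative of a function on `[0, ∞)` (one-sided at `0`). The function `f` is read as
the function `s ↦ f (max s 0)` of a real variable, differentiated within `[0, ∞)`. -/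
def timeDeriv (f : ℝ≥0 → E) (t : ℝ≥0) : E :=
  derivWithin (fun s : ℝ => f s.toNNReal) (Ici 0) (t : ℝ)

/-- `f` belongs to `C^∞_loc([0, ∞), E)`: it can be differentiated infinitely often. -/
def IsSmooth (f : ℝ≥0 → E) : Prop :=
  ∀ (k : ℕ) (t : ℝ≥0),
    DifferentiableWithinAt ℝ (fun s : ℝ => (timeDeriv^[k] f) s.toNNReal) (Ici 0) (t : ℝ)

/-- `f` vanishes: `f t → 0` as `t → ∞`. -/
def Vanishes (f : ℝ≥0 → E) : Prop :=
  Tendsto f atTop (𝓝 0)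

/-- `f` vanishes smoothly: every derivative of `f` tends to `0` as `t → ∞`. -/
def VanishesSmoothly (f : ℝ≥0 → E) : Prop :=
  ∀ k : ℕ, Vanishes (timeDeriv^[k] f)

end Time

/-! ### Input-output relations -/

section Relations

variable {U Y : Type*} [AddCommGroup U] [Module ℂ U] [TopologicalSpace U]
  [AddCommGroup Y] [Module ℂ Y] [TopologicalSpace Y]

/-- Every output for the zero input vanishes. -/
def IsStable (P : Set ((ℝ≥0 → U) × (ℝ≥0 → Y))) : Prop :=
  ∀ y, (0, y) ∈ P → Vanishes y

/-- Vanishing input, vanishing output. -/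
def IsVIVO (P : Set ((ℝ≥0 → U) × (ℝ≥0 → Y))) : Prop :=
  ∀ u y, (u, y) ∈ P → Vanishes u → Vanishes y

/-- Smoothly vanishing input, smoothly vanishing output. -/
def IsSmoothlyVIVO (P : Set ((ℝ≥0 → U) × (ℝ≥0 → Y))) : Prop :=
  ∀ u y, (u, y) ∈ P → VanishesSmoothly u → VanishesSmoothly y

end Relations

/-! ### Operators, semigroups and abstract Cauchy problems -/

section Operators

variable {X : Type*} [NormedAddCommGroup X] [NormedSpace ℂ X]

/-- `z` lies in the resolvent set of `A`, and the bounded operator `R` is the resolvent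
`(z - A)⁻¹`: it maps `X` into `Dom A` and is a two-sided inverse of `z - A : Dom A → X`. -/
def IsResolvent (A : X →ₗ.[ℂ] X) (z : ℂ) (R : X →L[ℂ] X) : Prop :=
  (∀ x : X, ∃ h : R x ∈ A.domain, z • R x - A ⟨R x, h⟩ = x) ∧
    ∀ x : A.domain, R (z • (x : X) - A x) = x

/-- The open sector `{t e^{iα} | t > 0, |α| < θ}`. -/
def sector (θ : ℝ) : Set ℂ :=
  {z | ∃ t α : ℝ, 0 < t ∧ |α| < θ ∧ z = t * Complex.exp (α * Complex.I)}

/-- `A` is densely defined, its resolvent set contains `ω + sector θ` for some real `ω` and some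
`θ > π / 2`, and `‖(z - A)⁻¹‖ ≤ K / |z - ω|` for all `z ∈ ω + sector θ`, with a constant `K`. -/
def IsSectorial (A : X →ₗ.[ℂ] X) : Prop :=
  Dense (A.domain : Set X) ∧
    ∃ ω θ K : ℝ, Real.pi / 2 < θ ∧
      ∀ z : ℂ, z - ω ∈ sector θ → ∃ R : X →L[ℂ] X, IsResolvent A z R ∧ ‖R‖ ≤ K / ‖z - ω‖

/-- The resolvent set of `A` is nonempty and all resolvents of `A` are compact. -/
def HasCompactResolvents (A : X →ₗ.[ℂ] X) : Prop :=
  (∃ (z : ℂ) (R : X →L[ℂ] X), IsResolvent A z R) ∧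
    ∀ (z : ℂ) (R : X →L[ℂ] X), IsResolvent A z R → IsCompactOperator R

/-- The domain of the product `(μ_m - A) ⋯ (μ_1 - A)` contains `v` and the product maps `v`
to `0`, where the list is `[μ_1, …, μ_m]`. -/
def ProductAnnihilates (A : X →ₗ.[ℂ] X) : List ℂ → X → Prop
  | [], v => v = 0
  | μ :: l, v => ∃ h : v ∈ A.domain, ProductAnnihilates A l (μ • v - A ⟨v, h⟩)

variable (X) in
/-- A strongly continuous semigroup on `X`. -/
structure C0Semigroup where
  /-- The operator `Φ t`. -/
  op : ℝ≥0 → X →L[ℂ] X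
  op_zero : op 0 = ContinuousLinearMap.id ℂ X
  op_add : ∀ s t, op (s + t) = (op s).comp (op t)
  continuous_op : ∀ x, Continuous fun t => op t x

/-- `A` is the generator of `Φ`: the pair `(x, y)` lies in the graph of `A` if and only if
`(Φ t x - Φ 0 x) / t` converges to `y` as `t → 0+`. -/
def IsGenerator (A : X →ₗ.[ℂ] X) (Φ : C0Semigroup X) : Prop :=
  ∀ x y : X, (x, y) ∈ A.graph ↔
    Tendsto (fun t : ℝ≥0 => (t : ℝ)⁻¹ • (Φ.op t x - Φ.op 0 x)) (𝓝[>] 0) (𝓝 y)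

variable {U Y : Type*} [AddCommGroup U] [Module ℂ U] [TopologicalSpace U]
  [AddCommGroup Y] [Module ℂ Y] [TopologicalSpace Y]

/-- The unobservable subspace of `(Φ, C)`: the largest subspace of `ker C` that is invariant under
every `Φ t`, obtained as the supremum of all these subspaces. -/
def unobservableSubspace (Φ : C0Semigroup X) (C : X →L[ℂ] Y) : Submodule ℂ X :=
  sSup {V : Submodule ℂ X | (∀ v ∈ V, C v = 0) ∧ ∀ t, ∀ v ∈ V, Φ.op t v ∈ V}

/-- The `(U, Y)`-relation defined by `ẋ = A x + B u`, `y = C x + D u`: the set of pairs `(u, y)` of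
smooth functions for which there is a smooth `x` with values in `Dom A` solving the equations for
all `t ≥ 0`. -/
def cauchyRelation (A : X →ₗ.[ℂ] X) (B : U →L[ℂ] X) (C : X →L[ℂ] Y) (D : U →L[ℂ] Y) :
    Set ((ℝ≥0 → U) × (ℝ≥0 → Y)) :=
  {p | IsSmooth p.1 ∧ IsSmooth p.2 ∧ ∃ x : ℝ≥0 → X, IsSmooth x ∧
    (∀ t, ∃ h : x t ∈ A.domain, timeDeriv x t = A ⟨x t, h⟩ + B (p.1 t)) ∧
    ∀ t, p.2 t = C (x t) + D (p.1 t)}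

end Operators

/-- The unobservable subspace really is the largest `Φ`-invariant subspace of `ker C`. -/
theorem isGreatest_unobservableSubspace {X Y : Type*} [NormedAddCommGroup X] [NormedSpace ℂ X]
    [AddCommGroup Y] [Module ℂ Y] [TopologicalSpace Y] (Φ : C0Semigroup X) (C : X →L[ℂ] Y) :
    IsGreatest {V : Submodule ℂ X | (∀ v ∈ V, C v = 0) ∧ ∀ t, ∀ v ∈ V, Φ.op t v ∈ V}
      (unobservableSubspace Φ C) := by
  refine ⟨⟨?_, ?_⟩, fun V hV => le_sSup hV⟩
  · have h : unobservableSubspace Φ C ≤ LinearMap.ker (C : X →ₗ[ℂ] Y) :=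
      sSup_le fun V hV v hv => hV.1 v hv
    exact fun v hv => h hv
  · intro t
    have h : unobservableSubspace Φ C ≤
        (unobservableSubspace Φ C).comap (Φ.op t : X →ₗ[ℂ] X) :=
      sSup_le fun V hV v hv => (le_sSup hV : V ≤ unobservableSubspace Φ C) (hV.2 t v hv)
    exact fun v hv => h hv

end

/-!
Write `M = Φ 1` for the operator `e^A`, and let `V` be the span of the generalized eigenvectors of
`M` for eigenvalues `λ` with `|λ| ≥ 1` (`unstableSubspace`).

*Generation.* After a shift, `R z = (z - A)⁻¹` exists on the right half plane and is bounded by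
`K / |z|`. The semigroup is `e^{tA} = (2πi)⁻¹ ∫ e^w (w - tA)⁻² dw` over the fixed line `Re w = 1`.
Thanks to the square the integral converges absolutely; the parameter `t` occurs only in the scaled
resolvent, so the uniform bound in `t` is immediate and no contour has to be moved. Integration by
parts along the line shows that the `t`-derivative is `A e^{tA}`, with `A` expressed by the bounded
operator `R 1 - 1 = A R 1`; the semigroup law follows because `e^{(t - s)A} e^{(r + s)A}` is
constant in `s`, and strong continuity at `0` from the estimate `e^{tA} R 1 - R 1 = O(t)`. The
construction only uses the resolvent identity, so it is carried out for pseudo-resolvents in a Banach algebra.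
As `e^A` maps into the domain of `A`, it factors through a resolvent and is compact
(`IsSectorial.exists_isGenerator`); this applies to every semigroup generated by `A`, by uniqueness
(`IsGenerator.op_eq`).

*Stability implies the eigenvector condition.* If `(μ_m - A) ⋯ (μ_1 - A) v = 0` with `e^{μ_j} = λ`,
then `(M - λ)^m v = 0`, and the orbit of `v` is a smooth trajectory with zero input. If
its output vanishes, then so does the output for `(M - λ) v`, which is zero by induction; hence
`C Φ (t + k) v = λ^k C Φ t v` tends to `0` as `k → ∞`, and `C Φ t v = 0` because `|λ| ≥ 1`
(`output_eq_zero_of_vanishes`).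

*The eigenvector condition implies VIVO.* Since `M` is compact, `V` is finite-dimensional by a Riesz
lemma argument, and `M` induces on the Banach space `X ⧸ V` a compact operator without eigenvalues
outside the open unit disc. By the Fredholm alternative and the spectral radius formula, some power
`M ^ n` induces a map of norm at most `1 / 2` (`exists_norm_mk_pow_le_half`). On each generalized
eigenspace, `A` is an everywhere defined endomorphism, and the roots `μ` of its minimal polynomial
satisfy `e^μ = λ`; so `V` is unobservable and `C` factors through `X ⧸ V`. By the mean value
inequality for `s ↦ Φ (n - s) (x (t + s))`, the state satisfies `x (t + n) = M ^ n (x t) + o(1)`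
when the input vanishes, so its class in `X ⧸ V` tends to `0`, and with it the output
(`IsGenerator.isVIVO_cauchyRelation`). No spectral projection and no integral formula is needed.

*The remaining implications.* The relation is closed under differentiation because `A` is closed
(`timeDeriv_mem_cauchyRelation`), so VIVO implies smoothly VIVO; and smoothly VIVO implies stability
on applying it to the zero input.
-/

noncomputable section

/-! ### Time derivatives -/

/-- Multiplication by real scalars is continuous in a complex Fréchet space. -/
theorem FrechetSpace.continuousSMul_real {E : Type*} [AddCommGroup E] [Module ℂ E]
    [UniformSpace E] [FrechetSpace E] : ContinuousSMul ℝ E := by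
  obtain ⟨p, hp⟩ := FrechetSpace.exists_withSeminorms (E := E)
  have : ContinuousSMul ℂ E := hp.continuousSMul
  exact ⟨((Complex.continuous_ofReal.comp continuous_fst).smul continuous_snd :
    Continuous fun p : ℝ × E => (p.1 : ℂ) • p.2)⟩

theorem IsSmooth.deriv {E : Type*} [AddCommGroup E] [Module ℂ E] [TopologicalSpace E]
    {f : ℝ≥0 → E} (h : IsSmooth f) : IsSmooth (timeDeriv f) := fun k t => by
  rw [← Function.iterate_succ_apply]
  exact h (k + 1) t

section TimeDerivative

variable {E F : Type*} [AddCommGroup E] [Module ℂ E] [TopologicalSpace E]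
  [ContinuousSMul ℝ E] [AddCommGroup F] [Module ℂ F] [TopologicalSpace F] [ContinuousSMul ℝ F]

/-- The function `f` of nonnegative time has time derivative `f'` at `t` (one-sided at `0`). -/
def HasTimeDeriv (f : ℝ≥0 → E) (f' : E) (t : ℝ≥0) : Prop :=
  HasDerivWithinAt (fun s : ℝ => f s.toNNReal) f' (Ici 0) (t : ℝ)

theorem HasTimeDeriv.timeDeriv_eq [IsTopologicalAddGroup E] [T2Space E]
    {f : ℝ≥0 → E} {f' : E} {t : ℝ≥0}
    (h : HasTimeDeriv f f' t) : timeDeriv f t = f' := by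
  have hd : DifferentiableWithinAt ℝ (fun s : ℝ => f s.toNNReal) (Ici 0) (t : ℝ) := ⟨_, h⟩
  have hu : UniqueDiffWithinAt ℝ (Ici (0 : ℝ)) (t : ℝ) := uniqueDiffOn_Ici 0 _ t.2
  have := hu.eq hd.hasFDerivWithinAt h
  simp [timeDeriv, derivWithin, this]

theorem hasTimeDeriv_of_differentiable {f : ℝ≥0 → E} {t : ℝ≥0}
    (h : DifferentiableWithinAt ℝ (fun s : ℝ => f s.toNNReal) (Ici 0) (t : ℝ)) :
    HasTimeDeriv f (timeDeriv f t) t := by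
  have := h.hasFDerivWithinAt.hasDerivWithinAt
  exact this

theorem IsSmooth.hasTimeDeriv {f : ℝ≥0 → E} (h : IsSmooth f) (k : ℕ) (t : ℝ≥0) :
    HasTimeDeriv (timeDeriv^[k] f) (timeDeriv^[k + 1] f t) t := by
  rw [Function.iterate_succ_apply']
  exact hasTimeDeriv_of_differentiable (h k t)

theorem iterate_timeDeriv_eq [IsTopologicalAddGroup E] [T2Space E] {g : ℕ → ℝ≥0 → E}
    (hg : ∀ k t, HasTimeDeriv (g k) (g (k + 1) t) t) (k : ℕ) : timeDeriv^[k] (g 0) = g k := by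
  induction k with
  | zero => rfl
  | succ k ih =>
    rw [Function.iterate_succ_apply', ih]
    exact funext fun t => (hg k t).timeDeriv_eq

/-- A function is smooth as soon as it heads a sequence in which every function is
the derivative of the preceding one. -/
theorem isSmooth_of_seq [IsTopologicalAddGroup E] [T2Space E] {g : ℕ → ℝ≥0 → E}
    (hg : ∀ k t, HasTimeDeriv (g k) (g (k + 1) t) t) : IsSmooth (g 0) := fun k t => by
  rw [iterate_timeDeriv_eq hg]
  exact ⟨_, hg k t⟩

theorem HasTimeDeriv.add [IsTopologicalAddGroup E] {f g : ℝ≥0 → E} {f' g' : E} {t : ℝ≥0}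
    (hf : HasTimeDeriv f f' t) (hg : HasTimeDeriv g g' t) :
    HasTimeDeriv (fun s => f s + g s) (f' + g') t := by
  have h1 := HasFDerivWithinAt.isLittleOTVS hf
  have h2 := HasFDerivWithinAt.isLittleOTVS hg
  refine HasFDerivWithinAt.of_isLittleOTVS ((h1.add h2).congr_left fun s => ?_)
  simp only [Pi.add_apply, ContinuousLinearMap.toSpanSingleton_apply, smul_add]
  abel

theorem HasTimeDeriv.clm_comp {f : ℝ≥0 → E} {f' : E} {t : ℝ≥0} (hf : HasTimeDeriv f f' t)
    (L : E →L[ℂ] F) : HasTimeDeriv (fun s => L (f s)) (L f') t := by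
  have h1 := HasFDerivWithinAt.isLittleOTVS hf
  have h2 := ((L.restrictScalars ℝ).isBigOTVS_comp (f := fun x' : ℝ => f x'.toNNReal -
    f (t : ℝ).toNNReal - ContinuousLinearMap.toSpanSingleton ℝ f' (x' - t)) (l := 𝓝[Ici 0] (t : ℝ)))
  refine HasFDerivWithinAt.of_isLittleOTVS ((h2.trans_isLittleOTVS h1).congr_left fun s => ?_)
  simp

theorem hasTimeDeriv_zero (t : ℝ≥0) : HasTimeDeriv (fun _ => (0 : E)) 0 t :=
  HasFDerivWithinAt.of_isLittleOTVS
    ((Asymptotics.IsLittleOTVS.zero (E := E) (fun s : ℝ => s - t) _).congr_left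
      fun s => by simp)

theorem isSmooth_zero [IsTopologicalAddGroup E] [T2Space E] : IsSmooth (0 : ℝ≥0 → E) :=
  isSmooth_of_seq (g := fun _ _ => 0) fun _ t => hasTimeDeriv_zero t

theorem vanishesSmoothly_zero [IsTopologicalAddGroup E] [T2Space E] :
    VanishesSmoothly (0 : ℝ≥0 → E) := fun k => by
  have h : timeDeriv^[k] (fun _ => (0 : E)) = fun _ => 0 :=
    iterate_timeDeriv_eq (g := fun _ _ => 0) (fun _ t => hasTimeDeriv_zero t) k
  change Tendsto (timeDeriv^[k] (fun _ => (0 : E))) atTop (𝓝 0)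
  rw [h]
  exact tendsto_const_nhds

end TimeDerivative

/-! ### Differentiating trajectories -/

/-- A relation closed under differentiation that maps vanishing inputs to vanishing outputs maps
smoothly vanishing inputs to smoothly vanishing outputs. -/
theorem IsVIVO.isSmoothlyVIVO {U Y : Type*} [AddCommGroup U] [Module ℂ U] [TopologicalSpace U]
    [AddCommGroup Y] [Module ℂ Y] [TopologicalSpace Y]
    {P : Set ((ℝ≥0 → U) × (ℝ≥0 → Y))} (hP : IsVIVO P)
    (hd : ∀ u y, (u, y) ∈ P → (timeDeriv u, timeDeriv y) ∈ P) : IsSmoothlyVIVO P := by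
  intro u y huy hu k
  have : ∀ k, (timeDeriv^[k] u, timeDeriv^[k] y) ∈ P := fun k => by
    induction k with
    | zero => exact huy
    | succ k ih => simpa only [Function.iterate_succ_apply'] using hd _ _ ih
  exact hP _ _ (this k) (hu k)

section Trajectories

variable {X : Type*} [NormedAddCommGroup X] [NormedSpace ℂ X]

theorem HasTimeDeriv.continuousAt {f : ℝ≥0 → X} {f' : X} {t : ℝ≥0} (h : HasTimeDeriv f f' t) :
    ContinuousAt f t := by
  have h1 : ContinuousWithinAt (fun s : ℝ => f s.toNNReal) (Ici 0) (t : ℝ) :=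
    HasDerivWithinAt.continuousWithinAt h
  have h2 : Tendsto (fun s : ℝ≥0 => (s : ℝ)) (𝓝 t) (𝓝[Ici 0] (t : ℝ)) :=
    tendsto_nhdsWithin_iff.2 ⟨NNReal.continuous_coe.tendsto t, .of_forall fun s => s.2⟩
  simpa [ContinuousAt, Function.comp_def] using h1.tendsto.comp h2

theorem HasDerivWithinAt.hasTimeDeriv {f : ℝ → X} {f' : X} {t : ℝ≥0}
    (h : HasDerivWithinAt f f' (Ici 0) t) : HasTimeDeriv (fun s => f s) f' t :=
  h.congr (fun s hs => by simp [Real.coe_toNNReal s hs]) (by simp)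

theorem IsResolvent.eq_apply {A : X →ₗ.[ℂ] X} {z : ℂ} {R : X →L[ℂ] X} (hR : IsResolvent A z R)
    {x : X} (h : x ∈ A.domain) : x = R (z • x - A ⟨x, h⟩) :=
  (hR.2 ⟨x, h⟩).symm

/-- The resolvent characterizes the graph of `A`, and shows in particular that `A` is closed. -/
theorem IsResolvent.exists_apply_eq {A : X →ₗ.[ℂ] X} {z : ℂ} {R : X →L[ℂ] X}
    (hR : IsResolvent A z R) {x y : X} (hxy : x = R (z • x - y)) :
    ∃ h : x ∈ A.domain, A ⟨x, h⟩ = y := by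
  obtain ⟨h, h'⟩ := hR.1 (z • x - y)
  have hx : x ∈ A.domain := hxy ▸ h
  refine ⟨hx, ?_⟩
  have h2 : A ⟨R (z • x - y), h⟩ = A ⟨x, hx⟩ := by congr 2; exact hxy.symm
  rw [h2, ← hxy] at h'
  exact sub_right_injective h'

variable {U Y : Type*} [AddCommGroup U] [Module ℂ U] [TopologicalSpace U]
  [ContinuousSMul ℝ U]
  [AddCommGroup Y] [Module ℂ Y] [TopologicalSpace Y] [IsTopologicalAddGroup Y]
  [ContinuousSMul ℝ Y] [T2Space Y]

/-- The derivative of a trajectory is a trajectory, because `A` is closed. -/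
theorem timeDeriv_mem_cauchyRelation {A : X →ₗ.[ℂ] X} {z : ℂ} {R : X →L[ℂ] X}
    (hR : IsResolvent A z R) {B : U →L[ℂ] X} {C : X →L[ℂ] Y} {D : U →L[ℂ] Y}
    {u : ℝ≥0 → U} {y : ℝ≥0 → Y} (h : (u, y) ∈ cauchyRelation A B C D) :
    (timeDeriv u, timeDeriv y) ∈ cauchyRelation A B C D := by
  obtain ⟨hu, hy, x, hx, hxA, hxy⟩ := h
  dsimp only at hu hy hxA hxy
  have hu' := hu.hasTimeDeriv 0
  have hx' := hx.hasTimeDeriv 0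
  have hx'' := hx.hasTimeDeriv 1
  simp only [zero_add, Function.iterate_zero, id_eq, Function.iterate_one] at hu' hx' hx''
  refine ⟨hu.deriv, hy.deriv, timeDeriv x, hx.deriv, fun t => ?_, fun t => ?_⟩
  · -- differentiate the identity `x = R (z x - x' + B u)`
    have key : ∀ s, x s = R ((z • ContinuousLinearMap.id ℂ X) (x s) +
        ((-ContinuousLinearMap.id ℂ X) (timeDeriv x s) + B (u s))) := fun s => by
      obtain ⟨hs, hs'⟩ := hxA s
      rw [hs']
      conv_lhs => rw [hR.eq_apply hs]
      congr 1
      simp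
      abel
    have h1 := (((hx' t).clm_comp (z • ContinuousLinearMap.id ℂ X)).add
      (((hx'' t).clm_comp (-ContinuousLinearMap.id ℂ X)).add ((hu' t).clm_comp B))).clm_comp R
    rw [← funext key] at h1
    have h2 := h1.timeDeriv_eq
    obtain ⟨hd, hA⟩ := hR.exists_apply_eq (x := timeDeriv x t)
      (y := timeDeriv^[1 + 1] x t - B (timeDeriv u t)) (by
        conv_lhs => rw [h2]
        congr 1
        simp
        abel)
    refine ⟨hd, ?_⟩
    rw [hA]
    simp
  · have h1 := ((hx' t).clm_comp C).add ((hu' t).clm_comp D)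
    rw [← funext hxy] at h1
    exact h1.timeDeriv_eq

end Trajectories

/-! ### Strongly continuous semigroups and their generators -/

namespace C0Semigroup

variable {X : Type*} [NormedAddCommGroup X] [NormedSpace ℂ X]

theorem op_zero_apply (Φ : C0Semigroup X) (x : X) : Φ.op 0 x = x := by simp [Φ.op_zero]

theorem op_add_apply (Φ : C0Semigroup X) (s t : ℝ≥0) (x : X) :
    Φ.op (s + t) x = Φ.op s (Φ.op t x) := by simp [Φ.op_add]

theorem op_comm (Φ : C0Semigroup X) (s t : ℝ≥0) (x : X) :
    Φ.op s (Φ.op t x) = Φ.op t (Φ.op s x) := by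
  rw [← op_add_apply, add_comm, op_add_apply]

theorem op_nat_mul (Φ : C0Semigroup X) (n : ℕ) : Φ.op n = Φ.op 1 ^ n := by
  induction n with
  | zero => simp [Φ.op_zero]; rfl
  | succ n ih => rw [pow_succ', ← ih, Nat.cast_succ, add_comm, Φ.op_add]; rfl

variable [CompleteSpace X]

theorem exists_norm_op_le (Φ : C0Semigroup X) (a : ℝ≥0) :
    ∃ K : ℝ, 0 < K ∧ ∀ t ≤ a, ‖Φ.op t‖ ≤ K := by
  obtain ⟨K, hK⟩ := banach_steinhaus (g := fun t : Iic a => Φ.op t) fun x => by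
    have hc : IsCompact (Icc (0 : ℝ≥0) a) := isCompact_Icc
    obtain ⟨K, hK⟩ := hc.exists_bound_of_continuousOn (Φ.continuous_op x).continuousOn
    exact ⟨K, fun t => hK t ⟨zero_le, t.2⟩⟩
  refine ⟨max K 1, by positivity, fun t ht => (hK ⟨t, ht⟩).trans (le_max_left _ _)⟩

/-- A strongly continuous semigroup is jointly continuous, by the uniform boundedness principle. -/
theorem continuous_uncurry (Φ : C0Semigroup X) :
    Continuous fun p : ℝ≥0 × X => Φ.op p.1 p.2 := by
  refine continuous_iff_continuousAt.2 fun ⟨t, x⟩ => ?_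
  obtain ⟨K, hK0, hK⟩ := Φ.exists_norm_op_le (t + 1)
  have h1 : Tendsto (fun p : ℝ≥0 × X => Φ.op p.1 (p.2 - x)) (𝓝 (t, x)) (𝓝 0) := by
    have h2 : Tendsto (fun p : ℝ≥0 × X => K * ‖p.2 - x‖) (𝓝 (t, x)) (𝓝 0) :=
      Continuous.tendsto' (by fun_prop) _ _ (by simp)
    refine squeeze_zero_norm' ?_ h2
    have h3 : ∀ᶠ p : ℝ≥0 × X in 𝓝 (t, x), p.1 < t + 1 :=
      continuous_fst.continuousAt.eventually_lt_const (by simp)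
    filter_upwards [h3] with p hp
    exact (Φ.op p.1).le_of_opNorm_le (hK _ hp.le) _
  have h2 : Tendsto (fun p : ℝ≥0 × X => Φ.op p.1 x) (𝓝 (t, x)) (𝓝 (Φ.op t x)) :=
    ((Φ.continuous_op x).comp continuous_fst).tendsto _
  simpa [ContinuousAt] using h1.add h2

end C0Semigroup

section Generator

variable {X : Type*} [NormedAddCommGroup X] [NormedSpace ℂ X] {A : X →ₗ.[ℂ] X} {Φ : C0Semigroup X}

theorem IsGenerator.op_mem_graph (h : IsGenerator A Φ) {x y : X} (hxy : (x, y) ∈ A.graph)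
    (t : ℝ≥0) : (Φ.op t x, Φ.op t y) ∈ A.graph := by
  rw [h] at hxy ⊢
  refine (((Φ.op t).continuous.tendsto y).comp hxy).congr fun s => ?_
  simp only [Function.comp_apply, ContinuousLinearMap.map_smul_of_tower, map_sub]
  rw [Φ.op_comm 0, Φ.op_comm s]

variable [CompleteSpace X]

/-- For `A x = y`, the orbit `s ↦ Φ s x` has time derivative `Φ t y`: it has this right derivative
by the definition of the generator, hence is the integral of `s ↦ Φ s y`. -/
theorem IsGenerator.hasTimeDeriv_op (h : IsGenerator A Φ) {x y : X} (hxy : (x, y) ∈ A.graph)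
    (t : ℝ≥0) : HasTimeDeriv (fun s => Φ.op s x) (Φ.op t y) t := by
  have hcy : Continuous fun s : ℝ => Φ.op s.toNNReal y :=
    (Φ.continuous_op y).comp continuous_real_toNNReal
  have hcx : Continuous fun s : ℝ => Φ.op s.toNNReal x :=
    (Φ.continuous_op x).comp continuous_real_toNNReal
  have hint : ∀ s : ℝ, 0 ≤ s →
      Φ.op s.toNNReal x = x + ∫ r in (0 : ℝ)..s, Φ.op r.toNNReal y := fun s hs => by
    rw [intervalIntegral.integral_eq_sub_of_hasDeriv_right_of_le hs hcx.continuousOn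
      (f' := fun r => Φ.op r.toNNReal y) ?_ (hcy.intervalIntegrable _ _)]
    · simp [Φ.op_zero_apply]
    intro r hr
    have hr0 : 0 ≤ r := hr.1.le
    rw [hasDerivWithinAt_iff_tendsto_slope' (by simp)]
    have h1 := ((h _ _).1 hxy)
    have h2 : Tendsto (fun s : ℝ => (s - r).toNNReal) (𝓝[>] r) (𝓝[>] 0) := by
      refine tendsto_nhdsWithin_iff.2 ⟨tendsto_nhdsWithin_of_tendsto_nhds
        (Continuous.tendsto' (by fun_prop) _ _ (by simp)), ?_⟩
      filter_upwards [self_mem_nhdsWithin] with s hs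
      simpa using hs
    refine ((((Φ.op r.toNNReal).continuous.tendsto y).comp h1).comp h2).congr' ?_
    filter_upwards [self_mem_nhdsWithin] with s hs
    have hs' : r < s := hs
    have e : s.toNNReal = r.toNNReal + (s - r).toNNReal := by
      rw [← Real.toNNReal_add hr0 (by linarith)]
      simp
    simp only [Function.comp_apply, slope, vsub_eq_sub, e, Φ.op_add_apply,
      ContinuousLinearMap.map_smul_of_tower,
      map_sub, Φ.op_zero_apply, Real.coe_toNNReal _ (sub_nonneg.2 hs'.le)]
  have hd : HasDerivAt (fun s : ℝ => x + ∫ r in (0 : ℝ)..s, Φ.op r.toNNReal y)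
      (Φ.op (t : ℝ).toNNReal y) t :=
    (intervalIntegral.integral_hasDerivAt_right (hcy.intervalIntegrable _ _)
      (hcy.stronglyMeasurableAtFilter _ _) hcy.continuousAt).const_add x
  rw [Real.toNNReal_coe] at hd
  exact hd.hasDerivWithinAt.congr (fun s hs => hint s hs) (hint t t.2)

/-- If `x` solves `x' = A x + f` with `‖f‖ ≤ ε` on `[a, b]`, then `x b` differs little from
`Φ (b - a) (x a)`: the function `s ↦ Φ (b - s) (x s)` has right derivative `Φ (b - s) (f s)`. -/
theorem IsGenerator.norm_sub_op_le (h : IsGenerator A Φ) {x x' w : ℝ≥0 → X}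
    (hx : ∀ s, HasTimeDeriv x (x' s) s) (hw : ∀ s, (x s, w s) ∈ A.graph) {a b : ℝ≥0} (hab : a ≤ b)
    {ε K : ℝ} (hε : ∀ s ∈ Icc a b, ‖x' s - w s‖ ≤ ε) (hK : ∀ s ≤ b - a, ‖Φ.op s‖ ≤ K) :
    ‖x b - Φ.op (b - a) (x a)‖ ≤ K * ε * (b - a) := by
  have hxc : Continuous x := continuous_iff_continuousAt.2 fun s => (hx s).continuousAt
  have hK0 : 0 ≤ K := (norm_nonneg _).trans (hK 0 zero_le)
  let g : ℝ → X := fun s => Φ.op (b - s).toNNReal (x s.toNNReal)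
  have hg : Continuous g := Φ.continuous_uncurry.comp
    ((continuous_real_toNNReal.comp (by fun_prop)).prodMk (hxc.comp continuous_real_toNNReal))
  have hd : ∀ s ∈ Ico (a : ℝ) b, HasDerivWithinAt g
      (Φ.op (b - s).toNNReal (x' s.toNNReal - w s.toNNReal)) (Ici s) s := by
    intro s hs
    have hs0 : 0 ≤ s := a.2.trans hs.1
    rw [← hasDerivWithinAt_Ioi_iff_Ici, hasDerivWithinAt_iff_tendsto_slope' (by simp)]
    have h1 : Tendsto (fun r : ℝ => (r - s)⁻¹ • (x r.toNNReal - x s.toNNReal)) (𝓝[>] s)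
        (𝓝 (x' s.toNNReal)) := by
      have h2 : HasDerivWithinAt (fun r : ℝ => x r.toNNReal) (x' s.toNNReal) (Ici 0) s := by
        simpa only [HasTimeDeriv, Real.coe_toNNReal _ hs0] using hx s.toNNReal
      have h3 := h2.mono (Ici_subset_Ici.2 hs0)
      rw [← hasDerivWithinAt_Ioi_iff_Ici, hasDerivWithinAt_iff_tendsto_slope' (by simp)] at h3
      exact h3
    have h2 : Tendsto (fun r : ℝ => (r - s).toNNReal) (𝓝[>] s) (𝓝[>] 0) := by
      refine tendsto_nhdsWithin_iff.2 ⟨tendsto_nhdsWithin_of_tendsto_nhds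
        (Continuous.tendsto' (by fun_prop) _ _ (by simp)), ?_⟩
      filter_upwards [self_mem_nhdsWithin] with r hr
      simpa using hr
    have h3 := ((h _ _).1 (hw s.toNNReal)).comp h2
    have h4 : Tendsto (fun r : ℝ => (b - r : ℝ).toNNReal) (𝓝[>] s) (𝓝 (b - s : ℝ).toNNReal) :=
      tendsto_nhdsWithin_of_tendsto_nhds (Continuous.tendsto' (by fun_prop) _ _ rfl)
    refine ((Φ.continuous_uncurry.tendsto _).comp (h4.prodMk_nhds (h1.sub h3))).congr' ?_
    filter_upwards [Ioo_mem_nhdsGT hs.2] with r hr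
    have e : (b - s : ℝ).toNNReal = (b - r : ℝ).toNNReal + (r - s).toNNReal := by
      rw [← Real.toNNReal_add (by linarith [hr.2]) (by linarith [hr.1])]
      simp
    simp only [Function.comp_apply, slope, vsub_eq_sub, g, e, Φ.op_add_apply,
      ContinuousLinearMap.map_smul_of_tower,
      map_sub, Φ.op_zero_apply, Real.coe_toNNReal _ (sub_nonneg.2 hr.1.le), smul_sub]
    abel
  have := norm_image_sub_le_of_norm_deriv_right_le_segment hg.continuousOn hd (C := K * ε)
    (fun s hs => by
      have hs0 : 0 ≤ s := a.2.trans hs.1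
      refine ((Φ.op _).le_of_opNorm_le (hK _ ?_) _).trans
        (mul_le_mul_of_nonneg_left (hε _ ⟨?_, ?_⟩) hK0)
      · rw [Real.toNNReal_le_iff_le_coe, NNReal.coe_sub hab]
        linarith [hs.1]
      · exact (Real.le_toNNReal_iff_coe_le hs0).2 hs.1
      · exact Real.toNNReal_le_iff_le_coe.2 hs.2.le) b ⟨hab, le_rfl⟩
  have e : ((b : ℝ) - a).toNNReal = b - a := rfl
  simpa [g, Φ.op_zero_apply, e] using this

theorem IsGenerator.eq_op_of_hasTimeDeriv (h : IsGenerator A Φ) {x w : ℝ≥0 → X}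
    (hx : ∀ s, HasTimeDeriv x (w s) s) (hw : ∀ s, (x s, w s) ∈ A.graph) (t : ℝ≥0) :
    x t = Φ.op t (x 0) := by
  obtain ⟨K, -, hK⟩ := Φ.exists_norm_op_le (t - 0)
  have := h.norm_sub_op_le hx hw (zero_le : 0 ≤ t) (ε := 0) (by simp) hK
  simpa [sub_eq_zero] using this

/-- Two semigroups with the same densely defined generator agree. -/
theorem IsGenerator.op_eq (h : IsGenerator A Φ) {Ψ : C0Semigroup X} (h' : IsGenerator A Ψ)
    (hA : Dense (A.domain : Set X)) (t : ℝ≥0) : Φ.op t = Ψ.op t := by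
  refine ContinuousLinearMap.coeFn_injective
    ((Φ.op t).continuous.ext_on hA (Ψ.op t).continuous fun x hx => ?_)
  have hg := A.mem_graph ⟨x, hx⟩
  simpa [Φ.op_zero_apply] using
    h'.eq_op_of_hasTimeDeriv (h.hasTimeDeriv_op hg) (fun s => h.op_mem_graph hg s) t

theorem IsGenerator.op_eq_exp_smul (h : IsGenerator A Φ) {x : X} {μ : ℂ}
    (hx : (x, μ • x) ∈ A.graph) (t : ℝ≥0) : Φ.op t x = Complex.exp (μ * t) • x := by
  have hd : ∀ s : ℝ≥0, HasTimeDeriv (fun s : ℝ≥0 => Complex.exp (μ * s) • x)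
      (Complex.exp (μ * s) • μ • x) s := fun s => by
    have h1 : HasDerivAt (fun r : ℝ => Complex.exp (μ * r))
        (Complex.exp (μ * s) * (μ * 1)) (s : ℝ) :=
      ((Complex.ofRealCLM.hasDerivAt).const_mul μ).cexp
    have h2 := (h1.smul_const x).hasDerivWithinAt (s := Ici 0)
    rw [mul_one, mul_smul] at h2
    exact h2.hasTimeDeriv
  have := h.eq_op_of_hasTimeDeriv hd (fun s => A.graph.smul_mem _ hx) t
  simpa using this.symm

end Generator

/-! ### Compact operators outside the open unit disc -/

section CompactOperator

open Module End

variable {X : Type*} [NormedAddCommGroup X] [NormedSpace ℂ X]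

/-- The span of the generalized eigenvectors of `M` for eigenvalues outside the open unit disc. -/
def unstableSubspace (M : X →L[ℂ] X) : Submodule ℂ X :=
  ⨆ (lam : ℂ) (_ : 1 ≤ ‖lam‖), maxGenEigenspace (M : End ℂ X) lam

theorem maxGenEigenspace_le_unstableSubspace (M : X →L[ℂ] X) {lam : ℂ} (h : 1 ≤ ‖lam‖) :
    maxGenEigenspace (M : End ℂ X) lam ≤ unstableSubspace M :=
  le_iSup₂_of_le lam h le_rfl

theorem unstableSubspace_invariant (M : X →L[ℂ] X) {v : X} (hv : v ∈ unstableSubspace M) :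
    M v ∈ unstableSubspace M := by
  have : unstableSubspace M ≤ (unstableSubspace M).comap (M : End ℂ X) := iSup₂_le fun lam h w hw =>
    maxGenEigenspace_le_unstableSubspace M h
      (mapsTo_maxGenEigenspace_of_comm (Commute.refl (M : End ℂ X)) lam hw)
  exact this hv

/-- One step of the Riesz chain: a finite-dimensional invariant subspace `W` that misses part of
the unstable subspace has a finite-dimensional invariant extension with a unit vector `u` far from
`W` which is an eigenvector modulo `W`. -/
theorem exists_riesz_step {M : X →L[ℂ] X} {W : Submodule ℂ X} [FiniteDimensional ℂ W]
    (hW : ∀ w ∈ W, M w ∈ W) (hV : ¬ unstableSubspace M ≤ W) :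
    ∃ (W' : Submodule ℂ X) (u : X), FiniteDimensional ℂ W' ∧ (∀ w ∈ W', M w ∈ W') ∧ W ≤ W' ∧
      u ∈ W' ∧ ‖u‖ = 1 ∧ (∀ w ∈ W, 1 / 2 ≤ ‖u - w‖) ∧ ∃ lam : ℂ, 1 ≤ ‖lam‖ ∧ M u - lam • u ∈ W := by
  obtain ⟨lam, hlam, v, hv, hvW⟩ : ∃ lam : ℂ, 1 ≤ ‖lam‖ ∧
      ∃ v ∈ maxGenEigenspace (M : End ℂ X) lam, v ∉ W := by
    by_contra! h
    exact hV (iSup₂_le h)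
  obtain ⟨k, hk⟩ := (mem_maxGenEigenspace _ _ _).1 hv
  let S : End ℂ X := (M : End ℂ X) - lam • (1 : End ℂ X)
  -- the last vector of the Jordan chain of `v` outside `W`
  obtain ⟨v', hv', hSv'⟩ : ∃ v', v' ∉ W ∧ S v' ∈ W := by
    classical
    have hex : ∃ k, (S ^ k) v ∈ W := ⟨k, by rw [hk]; exact W.zero_mem⟩
    have h0 : Nat.find hex ≠ 0 := fun h => hvW (by simpa [h] using Nat.find_spec hex)
    refine ⟨(S ^ (Nat.find hex - 1)) v, Nat.find_min hex (by omega), ?_⟩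
    rw [← Module.End.mul_apply, ← pow_succ', Nat.sub_add_cancel (by omega)]
    exact Nat.find_spec hex
  have hcl : IsClosed (W : Set X) := W.closed_of_finiteDimensional
  have hne : (W : Set X).Nonempty := ⟨0, W.zero_mem⟩
  have hd : 0 < Metric.infDist v' (W : Set X) := (hcl.notMem_iff_infDist_pos hne).1 hv'
  obtain ⟨w₀, hw₀, hdist⟩ := (Metric.infDist_lt_iff hne).1
    (show Metric.infDist v' (W : Set X) < 2 * Metric.infDist v' (W : Set X) by linarith)
  rw [dist_eq_norm] at hdist
  set c : ℝ := ‖v' - w₀‖ with hc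
  have hc0 : 0 < c := norm_pos_iff.2 fun h => hv' (by rwa [sub_eq_zero.1 h])
  have hcC : (c : ℂ) ≠ 0 := by exact_mod_cast hc0.ne'
  let u : X := (c : ℂ)⁻¹ • (v' - w₀)
  have hMu : M u - lam • u ∈ W := by
    have h1 : M u - lam • u = (c : ℂ)⁻¹ • (S v' - (M w₀ - lam • w₀)) := by
      simp only [u, S, map_smul, map_sub, LinearMap.sub_apply, LinearMap.smul_apply,
        Module.End.one_apply, ContinuousLinearMap.coe_coe]
      module
    rw [h1]
    exact W.smul_mem _ (W.sub_mem hSv' (W.sub_mem (hW _ hw₀) (W.smul_mem _ hw₀)))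
  refine ⟨W ⊔ ℂ ∙ u, u, inferInstance, fun w hw => ?_, le_sup_left,
    Submodule.mem_sup_right (Submodule.mem_span_singleton_self u), ?_, fun w hw => ?_,
    lam, hlam, hMu⟩
  · obtain ⟨a, ha, b, hb, rfl⟩ := Submodule.mem_sup.1 hw
    obtain ⟨r, rfl⟩ := Submodule.mem_span_singleton.1 hb
    have h1 : M (a + r • u) = (M a + r • (M u - lam • u)) + (r * lam) • u := by
      simp only [map_add, map_smul]
      module
    rw [h1]
    exact Submodule.add_mem_sup (W.add_mem (hW a ha) (W.smul_mem _ hMu))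
      (Submodule.smul_mem _ _ (Submodule.mem_span_singleton_self u))
  · simp [u, norm_smul, ← hc, abs_of_pos hc0, hc0.ne']
  · have h1 : u - w = (c : ℂ)⁻¹ • (v' - (w₀ + (c : ℂ) • w)) := by
      simp only [u, smul_sub, smul_add, smul_smul, inv_mul_cancel₀ hcC, one_smul]
      abel
    have h2 : Metric.infDist v' (W : Set X) ≤ ‖v' - (w₀ + (c : ℂ) • w)‖ := by
      rw [← dist_eq_norm]
      exact Metric.infDist_le_dist_of_mem (W.add_mem hw₀ (W.smul_mem _ hw))
    rw [h1, norm_smul, norm_inv, Complex.norm_real, Real.norm_of_nonneg hc0.le,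
      ← div_eq_inv_mul, le_div_iff₀ hc0]
    linarith

/-- The unstable subspace of a compact operator is finite-dimensional: otherwise the unit vectors of
an infinite Riesz chain would be mapped to a separated sequence. -/
theorem finiteDimensional_unstableSubspace {M : X →L[ℂ] X} (hM : IsCompactOperator M) :
    FiniteDimensional ℂ (unstableSubspace M) := by
  by_contra hV
  let G := {W : Submodule ℂ X // FiniteDimensional ℂ W ∧ ∀ w ∈ W, M w ∈ W}
  have step : ∀ W : G, ∃ (W' : G) (u : X), W.1 ≤ W'.1 ∧ u ∈ W'.1 ∧ ‖u‖ = 1 ∧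
      (∀ w ∈ W.1, 1 / 2 ≤ ‖u - w‖) ∧ ∃ lam : ℂ, 1 ≤ ‖lam‖ ∧ M u - lam • u ∈ W.1 := by
    rintro ⟨W, hfin, hinv⟩
    have hnot : ¬ unstableSubspace M ≤ W := fun h => hV (Submodule.finiteDimensional_of_le h)
    obtain ⟨W', u, h1, h2, h3⟩ := exists_riesz_step hinv hnot
    exact ⟨⟨W', h1, h2⟩, u, h3⟩
  choose next u hle hmem hnorm hfar lam hlam hsub using step
  let W : ℕ → G := fun n => next^[n] ⟨⊥, inferInstance, by simp⟩
  have hW : ∀ n, W (n + 1) = next (W n) := fun n => Function.iterate_succ_apply' _ _ _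
  have hmono : Monotone fun n => (W n).1 := monotone_nat_of_le_succ fun n => by
    rw [hW]; exact hle _
  have hsep : ∀ m n, m < n → 1 / 2 ≤ ‖M (u (W n)) - M (u (W m))‖ := fun m n hmn => by
    have h1 : M (u (W m)) ∈ (W n).1 := (W n).2.2 _ (hmono (Nat.succ_le_of_lt hmn) (by
      show _ ∈ (W (m + 1)).1
      rw [hW]; exact hmem _))
    have h0 : lam (W n) ≠ 0 := norm_pos_iff.1 (one_pos.trans_le (hlam _))
    have h2 := hfar (W n) ((lam (W n))⁻¹ •
      (M (u (W m)) - (M (u (W n)) - lam (W n) • u (W n))))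
      (Submodule.smul_mem _ _ (Submodule.sub_mem _ h1 (hsub _)))
    have h3 : M (u (W n)) - M (u (W m)) = lam (W n) • (u (W n) - (lam (W n))⁻¹ •
        (M (u (W m)) - (M (u (W n)) - lam (W n) • u (W n)))) := by
      rw [smul_sub, smul_inv_smul₀ h0]
      abel
    rw [h3, norm_smul]
    nlinarith [hlam (W n)]
  obtain ⟨K, hK, hK'⟩ := hM.image_closedBall_subset_compact (f := (M : X →ₗ[ℂ] X)) (1 : ℝ)
  obtain ⟨y, -, ψ, hψ, hψy⟩ := hK.tendsto_subseq (x := fun n => M (u (W n)))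
    (fun n => hK' ⟨u (W n), by simp [hnorm], rfl⟩)
  obtain ⟨N, hN⟩ := Metric.cauchySeq_iff'.1 hψy.cauchySeq (1 / 2) (by norm_num)
  have h1 := hN (N + 1) (by omega)
  rw [dist_eq_norm] at h1
  exact absurd (hsep _ _ (hψ (Nat.lt_succ_self N))) (not_le.2 h1)

/-- A vector that `M - λ` maps into a finite-dimensional unstable subspace lies in it, by the
Fitting decomposition of `M - λ` on that subspace. -/
theorem mem_unstableSubspace_of_sub_mem {M : X →L[ℂ] X}
    [FiniteDimensional ℂ (unstableSubspace M)] {lam : ℂ} (hlam : 1 ≤ ‖lam‖) {v : X}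
    (hv : M v - lam • v ∈ unstableSubspace M) : v ∈ unstableSubspace M := by
  set V := unstableSubspace M with hVdef
  let S : End ℂ X := (M : End ℂ X) - lam • (1 : End ℂ X)
  have hS : ∀ w, S w = M w - lam • w := fun w => by simp [S]
  have hSV : ∀ w ∈ V, S w ∈ V := fun w hw => by
    rw [hS]
    exact V.sub_mem (unstableSubspace_invariant M hw) (V.smul_mem _ hw)
  let g : End ℂ V := S.restrict hSV
  obtain ⟨n, hcompl, hn⟩ := (g.eventually_isCompl_ker_pow_range_pow.and
    (eventually_ge_atTop 1)).exists
  have hgn : ∀ (k : ℕ) (w : V), ((g ^ k) w : X) = (S ^ k) w := fun k w => by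
    rw [Module.End.pow_restrict k hSV]; rfl
  obtain ⟨a, ha, b, ⟨c, rfl⟩, hab⟩ := Submodule.mem_sup.1
    (hcompl.sup_eq_top ▸ Submodule.mem_top : (⟨S v, hv⟩ : V) ∈ _)
  have h1 : (a : X) + (S ^ n) c = S v := by
    rw [← hgn]; exact congrArg Subtype.val hab
  have h2 : v - (S ^ (n - 1)) c ∈ maxGenEigenspace (M : End ℂ X) lam := by
    refine (mem_maxGenEigenspace _ _ _).2 ⟨n + 1, ?_⟩
    change (S ^ (n + 1)) _ = 0
    rw [pow_succ, Module.End.mul_apply, map_sub S, ← Module.End.mul_apply S, ← pow_succ',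
      Nat.sub_add_cancel hn, ← h1, add_sub_cancel_right, ← hgn, LinearMap.mem_ker.1 ha]
    rfl
  have h3 : (S ^ (n - 1)) (c : X) ∈ V := by
    rw [← hgn]; exact Subtype.property _
  have := V.add_mem (maxGenEigenspace_le_unstableSubspace M hlam h2) h3
  simpa using this

/-- Gelfand's formula for an operator whose spectrum lies in the open unit disc. -/
theorem exists_norm_pow_le_half_of_spectrum {E : Type*} [NormedAddCommGroup E] [NormedSpace ℂ E]
    [CompleteSpace E] (T : E →L[ℂ] E) (hT : ∀ z ∈ spectrum ℂ T, ‖z‖ < 1) :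
    ∃ n : ℕ, 0 < n ∧ ‖T ^ n‖ ≤ 1 / 2 := by
  rcases subsingleton_or_nontrivial E with hE | hE
  · exact ⟨1, one_pos, by simp [Subsingleton.elim T 0]⟩
  have h1 : spectralRadius ℂ T < (1 : ℝ≥0) :=
    spectrum.spectralRadius_lt_of_forall_lt T fun z hz => hT z hz
  obtain ⟨r, hr1, hr2⟩ := ENNReal.lt_iff_exists_nnreal_btwn.1 h1
  have hr2' : r < 1 := by simpa using hr2
  have h2 := (spectrum.pow_nnnorm_pow_one_div_tendsto_nhds_spectralRadius T).eventually_lt_const hr1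
  have h3 : ∀ᶠ n : ℕ in atTop, r ^ n < 1 / 2 :=
    (tendsto_pow_atTop_nhds_zero_of_lt_one (zero_le) hr2').eventually_lt_const (by norm_num)
  obtain ⟨n, hn2, hn3, hn⟩ := (h2.and (h3.and (eventually_ge_atTop 1))).exists
  refine ⟨n, hn, ?_⟩
  have h4 : (‖T ^ n‖₊ : ENNReal) ≤ (r : ENNReal) ^ n := by
    have := ENNReal.rpow_le_rpow hn2.le (z := n) (by positivity)
    rwa [← ENNReal.rpow_mul, one_div_mul_cancel (by positivity), ENNReal.rpow_one,
      ENNReal.rpow_natCast] at this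
  have h5 : ‖T ^ n‖₊ ≤ r ^ n := by exact_mod_cast h4
  have h6 : ‖T ^ n‖₊ ≤ 1 / 2 := h5.trans hn3.le
  exact_mod_cast h6

/-- Modulo its unstable subspace, some power of a compact operator is a contraction. -/
theorem exists_norm_mk_pow_le_half [CompleteSpace X] {M : X →L[ℂ] X} (hM : IsCompactOperator M) :
    ∃ n : ℕ, 0 < n ∧ ∀ x, ‖(unstableSubspace M).mkQ ((M ^ n) x)‖ ≤
      1 / 2 * ‖(unstableSubspace M).mkQ x‖ := by
  have hfin := finiteDimensional_unstableSubspace hM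
  set V := unstableSubspace M with hV
  have hcl : IsClosed (V : Set X) := V.closed_of_finiteDimensional
  let T : (X ⧸ V) →L[ℂ] (X ⧸ V) := V.liftQL (V.mkQL.comp M) fun v hv => by
    simpa using unstableSubspace_invariant M hv
  have hTmk : ∀ x, T (V.mkQ x) = V.mkQ (M x) := fun x => by simp [T]
  have hTpow : ∀ (n : ℕ) x, (T ^ n) (V.mkQ x) = V.mkQ ((M ^ n) x) := fun n => by
    induction n with
    | zero => intro x; rfl
    | succ n ih => intro x; rw [pow_succ, pow_succ, mul_apply_eq_comp,
        mul_apply_eq_comp, hTmk, ih]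
  have hT : IsCompactOperator T := by
    obtain ⟨K, hK, hK0⟩ := hM
    refine ⟨V.mkQ '' K, hK.image V.mkQL.continuous, ?_⟩
    have h1 : V.mkQL '' (M ⁻¹' K) ∈ 𝓝 (V.mkQL 0) :=
      V.isOpenQuotientMap_mkQL.isOpenMap.image_mem_nhds hK0
    rw [map_zero] at h1
    filter_upwards [h1]
    rintro _ ⟨x, hx, rfl⟩
    exact ⟨M x, hx, (hTmk x).symm⟩
  obtain ⟨n, hn, hle⟩ := exists_norm_pow_le_half_of_spectrum T fun z hz => by
    by_contra! h
    have hz0 : z ≠ 0 := norm_pos_iff.1 (one_pos.trans_le h)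
    obtain ⟨q, hq⟩ := ((hT.hasEigenvalue_iff_mem_spectrum hz0).2 hz).exists_hasEigenvector
    obtain ⟨v, rfl⟩ := V.mkQ_surjective q
    have h1 : M v - z • v ∈ V := by
      have := hq.apply_eq_smul
      rw [ContinuousLinearMap.coe_coe, hTmk, ← map_smul, ← sub_eq_zero, ← map_sub] at this
      exact (Submodule.Quotient.mk_eq_zero V).1 this
    exact hq.2 (by simpa using mem_unstableSubspace_of_sub_mem h h1)
  exact ⟨n, hn, fun x => by rw [← hTpow]; exact (T ^ n).le_of_opNorm_le hle _⟩

end CompactOperator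

/-! ### Inverse Laplace transforms of pseudo-resolvents -/

section InverseLaplace

open MeasureTheory Complex

/-- The point with ordinate `σ` of the vertical line `Re w = 1`. -/
def verticalLine (σ : ℝ) : ℂ := 1 + σ * I

@[simp] theorem verticalLine_re (σ : ℝ) : (verticalLine σ).re = 1 := by simp [verticalLine]

theorem norm_verticalLine_sq (σ : ℝ) : ‖verticalLine σ‖ ^ 2 = 1 + σ ^ 2 := by
  rw [← normSq_eq_norm_sq, normSq_apply]
  simp [verticalLine]
  ring

theorem one_le_norm_verticalLine (σ : ℝ) : 1 ≤ ‖verticalLine σ‖ := by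
  simpa using abs_re_le_norm (verticalLine σ)

theorem verticalLine_ne_zero (σ : ℝ) : verticalLine σ ≠ 0 :=
  norm_pos_iff.1 (one_pos.trans_le (one_le_norm_verticalLine σ))

theorem norm_exp_verticalLine (σ : ℝ) : ‖cexp (verticalLine σ)‖ = Real.exp 1 := by
  rw [norm_exp, verticalLine_re]

theorem hasDerivAt_verticalLine (σ : ℝ) : HasDerivAt verticalLine I σ := by
  exact (((ofRealCLM.hasDerivAt (x := σ)).mul_const I).const_add 1).congr_deriv (by simp)

theorem continuous_verticalLine : Continuous verticalLine :=
  continuous_iff_continuousAt.2 fun σ => (hasDerivAt_verticalLine σ).continuousAt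

/-- The inverse Laplace transform of `w⁻²` at `1`, obtained from Mellin inversion for
`x ↦ log x` on `(0, 1]`, whose Mellin transform is `-s⁻²`. -/
theorem integral_exp_mul_inv_sq_verticalLine :
    (2 * Real.pi)⁻¹ • ∫ σ : ℝ, cexp (verticalLine σ) * ((verticalLine σ)⁻¹ ^ 2) = 1 := by
  let f : ℝ → ℂ := indicator (Ioc 0 1) (fun _ => 1)
  have hf_int : LocallyIntegrableOn f (Ioi 0) := by
    refine IntegrableOn.locallyIntegrableOn (Integrable.integrableOn ?_)
    exact (integrable_indicator_iff measurableSet_Ioc).2 (by simp)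
  have hmell : ∀ s : ℂ, 0 < s.re → MellinConvergent (fun t => Real.log t • f t) s ∧
      mellin (fun t => Real.log t • f t) s = -(s⁻¹ ^ 2) := by
    intro s hs
    have htop : f =O[atTop] (· ^ (-(s.re + 1))) := by
      refine Asymptotics.IsBigO.congr' (f₁ := fun _ => (0 : ℂ)) (Asymptotics.isBigO_zero _ _) ?_
        EventuallyEq.rfl
      filter_upwards [eventually_gt_atTop 1] with x hx
      simp [f, hx]
    have hbot : f =O[𝓝[>] 0] (· ^ (-(0 : ℝ))) := by
      refine Asymptotics.IsBigO.of_bound 1 (Eventually.of_forall fun x => ?_)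
      by_cases hx : x ∈ Ioc (0 : ℝ) 1 <;> simp [f, hx]
    obtain ⟨h1, h2⟩ := mellin_hasDerivAt_of_isBigO_rpow hf_int htop (by linarith) hbot hs
    refine ⟨h1, h2.unique ?_⟩
    have hs0 : s ≠ 0 := by rintro rfl; simp at hs
    have h3 := hasDerivAt_inv hs0
    have h4 : HasDerivAt (mellin f) (-(s ^ 2)⁻¹) s := by
      refine h3.congr_of_eventuallyEq ?_
      filter_upwards [(isOpen_lt continuous_const continuous_re).mem_nhds hs] with z hz
      rw [(hasMellin_one_Ioc hz).2, one_div]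
    rwa [← inv_pow] at h4
  have hline : ∀ y : ℝ, ((1 : ℝ) : ℂ) + y * I = verticalLine y := fun y => by simp [verticalLine]
  have hline0 : ∀ y : ℝ, 0 < (verticalLine y).re := fun y => by simp
  have key := mellinInv_mellin_eq (1 : ℝ) (fun t => Real.log t • f t) (x := Real.exp (-1))
    (Real.exp_pos _) (hmell _ (by simp)).1 ?_ ?_
  · simp only [mellinInv, hline, (hmell _ (hline0 _)).2, Real.log_exp] at key
    have h1 : ∀ y, ((Real.exp (-1) : ℝ) : ℂ) ^ (-verticalLine y) • -((verticalLine y)⁻¹ ^ 2) =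
        -(cexp (verticalLine y) * (verticalLine y)⁻¹ ^ 2) := fun y => by
      rw [cpow_def_of_ne_zero (by exact_mod_cast (Real.exp_pos _).ne'),
        ← ofReal_log (Real.exp_pos _).le, Real.log_exp]
      simp
    have h2 : f (Real.exp (-1)) = 1 := by
      have : Real.exp (-1) ∈ Ioc (0 : ℝ) 1 := ⟨Real.exp_pos _, Real.exp_le_one_iff.2 (by norm_num)⟩
      simp [f, this]
    simp only [h1, h2, integral_neg, smul_neg, one_div] at key
    simpa using key
  · unfold VerticalIntegrable
    simp only [hline, (hmell _ (hline0 _)).2]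
    refine (integrable_inv_one_add_sq.mono' ?_ (.of_forall fun y => ?_)).neg
    · exact ((continuous_verticalLine.inv₀ verticalLine_ne_zero).pow 2).aestronglyMeasurable
    · rw [norm_pow, norm_inv, inv_pow, norm_verticalLine_sq]
  · have h1 : Real.exp (-1) ∈ Ioo (0 : ℝ) 1 := ⟨Real.exp_pos _, by simp⟩
    have h2 : ContinuousAt (fun t : ℝ => ((Real.log t : ℝ) : ℂ)) (Real.exp (-1)) :=
      continuous_ofReal.continuousAt.comp (Real.continuousAt_log (Real.exp_pos _).ne')
    refine h2.congr ?_
    filter_upwards [isOpen_Ioo.mem_nhds h1] with t ht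
    simp [f, show t ∈ Ioc (0 : ℝ) 1 from ⟨ht.1, ht.2.le⟩]

theorem integrable_of_continuous_of_norm_le {E : Type*} [NormedAddCommGroup E] {f : ℝ → E}
    (hf : Continuous f) {c : ℝ} (hc : ∀ σ, ‖f σ‖ ≤ c * (1 + σ ^ 2)⁻¹) : Integrable f :=
  (integrable_inv_one_add_sq.const_mul c).mono' hf.aestronglyMeasurable (.of_forall hc)

variable {𝔄 : Type*} [NormedRing 𝔄] [NormedAlgebra ℂ 𝔄]

/-- `R` is a pseudo-resolvent on the right half plane with the bound `K / |z|`. -/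
structure IsHalfPlaneResolvent (R : ℂ → 𝔄) (K : ℝ) : Prop where
  sub_eq : ∀ z w : ℂ, 0 < z.re → 0 < w.re → R z - R w = (w - z) • (R z * R w)
  norm_le : ∀ z : ℂ, 0 < z.re → ‖R z‖ ≤ K / ‖z‖

/-- If `R z = (z - A)⁻¹`, then `scaledResolvent R t w = (w - t A)⁻¹`. -/
def scaledResolvent (R : ℂ → 𝔄) (t : ℝ) (w : ℂ) : 𝔄 := (t : ℂ)⁻¹ • R (w / t)

/-- The integrand of the inverse Laplace transform defining `e^{tA}`. -/
def semigroupIntegrand (R : ℂ → 𝔄) (t σ : ℝ) : 𝔄 :=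
  cexp (verticalLine σ) • scaledResolvent R t (verticalLine σ) ^ 2

/-- If `R z = (z - A)⁻¹`, then `holomorphicSemigroup R t = e^{tA}` for `t > 0`, in the form
`(2πi)⁻¹ ∫ e^w (w - t A)⁻² dw` over the line `Re w = 1`. Squaring the resolvent makes the integral
converge absolutely, and no deformation of the contour is needed. -/
def holomorphicSemigroup (R : ℂ → 𝔄) (t : ℝ) : 𝔄 :=
  (2 * Real.pi)⁻¹ • ∫ σ : ℝ, semigroupIntegrand R t σ

/-- The derivative of `semigroupIntegrand R t σ` with respect to `t`. -/
def semigroupIntegrandDeriv (R : ℂ → 𝔄) (t σ : ℝ) : 𝔄 :=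
  cexp (verticalLine σ) • (2 * (t : ℂ)⁻¹) • (verticalLine σ •
    scaledResolvent R t (verticalLine σ) ^ 3 - scaledResolvent R t (verticalLine σ) ^ 2)

namespace IsHalfPlaneResolvent

variable {R : ℂ → 𝔄} {K : ℝ}

theorem mul_comm (h : IsHalfPlaneResolvent R K) {z w : ℂ} (hz : 0 < z.re) (hw : 0 < w.re) :
    R z * R w = R w * R z := by
  rcases eq_or_ne z w with rfl | hne
  · rfl
  have h1 := h.sub_eq z w hz hw
  rw [← neg_sub, h.sub_eq w z hw hz, ← neg_smul, neg_sub] at h1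
  exact (smul_right_injective 𝔄 (sub_ne_zero.2 hne.symm) h1).symm

theorem nonneg (h : IsHalfPlaneResolvent R K) : 0 ≤ K := by
  simpa using (norm_nonneg _).trans (h.norm_le 1 (by simp))

theorem continuousAt (h : IsHalfPlaneResolvent R K) {z : ℂ} (hz : 0 < z.re) : ContinuousAt R z := by
  have hz0 : ‖z‖ ≠ 0 := by rw [norm_ne_zero_iff]; rintro rfl; simp at hz
  rw [ContinuousAt, tendsto_iff_norm_sub_tendsto_zero]
  have h1 : Tendsto (fun w : ℂ => ‖z - w‖ * (K / ‖w‖ * ‖R z‖)) (𝓝 z) (𝓝 0) := by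
    have h2 : ContinuousAt (fun w : ℂ => ‖z - w‖ * (K / ‖w‖ * ‖R z‖)) z := by
      fun_prop (disch := exact hz0)
    simpa [ContinuousAt] using h2
  refine squeeze_zero' (.of_forall fun _ => norm_nonneg _) ?_ h1
  filter_upwards [(isOpen_lt continuous_const continuous_re).mem_nhds hz] with w hw
  rw [h.sub_eq w z hw hz, norm_smul]
  gcongr
  exact (norm_mul_le _ _).trans (by gcongr; exact h.norm_le w hw)

theorem hasDerivAt (h : IsHalfPlaneResolvent R K) {z : ℂ} (hz : 0 < z.re) :
    HasDerivAt R (-(R z ^ 2)) z := by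
  rw [hasDerivAt_iff_tendsto_slope]
  have h1 : Tendsto (fun w => -(R w * R z)) (𝓝[≠] z) (𝓝 (-(R z ^ 2))) := by
    rw [pow_two]
    exact (((h.continuousAt hz).tendsto.mul_const _).neg).mono_left nhdsWithin_le_nhds
  refine h1.congr' ?_
  filter_upwards [self_mem_nhdsWithin, nhdsWithin_le_nhds
    ((isOpen_lt continuous_const continuous_re).mem_nhds hz)] with w hne hw
  have h2 : w - z ≠ 0 := sub_ne_zero.2 hne
  rw [slope, vsub_eq_sub, h.sub_eq w z hw hz, ← neg_sub w z, neg_smul, smul_neg,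
    inv_smul_smul₀ h2]

theorem norm_scaledResolvent_le (h : IsHalfPlaneResolvent R K) {t : ℝ} (ht : 0 < t) (σ : ℝ) :
    ‖scaledResolvent R t (verticalLine σ)‖ ≤ K / ‖verticalLine σ‖ := by
  have h1 := h.norm_le (verticalLine σ / t) (by
    rw [div_ofReal_re, verticalLine_re]; positivity)
  rw [scaledResolvent, norm_smul, norm_inv, norm_real, Real.norm_of_nonneg ht.le]
  rw [norm_div, norm_real, Real.norm_of_nonneg ht.le] at h1
  have h2 := one_le_norm_verticalLine σ
  calc t⁻¹ * ‖R (verticalLine σ / t)‖ ≤ t⁻¹ * (K / (‖verticalLine σ‖ / t)) := by gcongr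
    _ = K / ‖verticalLine σ‖ := by field_simp

theorem norm_scaledResolvent_pow_le (h : IsHalfPlaneResolvent R K) {t : ℝ} (ht : 0 < t) (σ : ℝ)
    {n : ℕ} (hn : 0 < n) :
    ‖scaledResolvent R t (verticalLine σ) ^ n‖ ≤ K ^ n / ‖verticalLine σ‖ ^ n := by
  rw [← div_pow]
  exact (norm_pow_le' _ hn).trans
    (pow_le_pow_left₀ (norm_nonneg _) (h.norm_scaledResolvent_le ht σ) n)

theorem hasDerivAt_scaledResolvent_line (h : IsHalfPlaneResolvent R K) {t : ℝ} (ht : 0 < t)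
    (σ : ℝ) : HasDerivAt (fun σ => scaledResolvent R t (verticalLine σ))
      (-(I • scaledResolvent R t (verticalLine σ) ^ 2)) σ := by
  have h0 : 0 < (verticalLine σ / t).re := by rw [div_ofReal_re, verticalLine_re]; positivity
  have h1 := ((h.hasDerivAt h0).scomp σ ((hasDerivAt_verticalLine σ).div_const (t : ℂ))).const_smul
    (t : ℂ)⁻¹
  refine h1.congr_deriv ?_
  rw [scaledResolvent, smul_pow, smul_neg, smul_neg, smul_smul, smul_smul]
  congr 2
  ring

theorem hasDerivAt_scaledResolvent_time (h : IsHalfPlaneResolvent R K) {t : ℝ} (ht : 0 < t)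
    (σ : ℝ) : HasDerivAt (fun t => scaledResolvent R t (verticalLine σ))
      ((t : ℂ)⁻¹ • (verticalLine σ • scaledResolvent R t (verticalLine σ) ^ 2 -
        scaledResolvent R t (verticalLine σ))) t := by
  have h0 : 0 < (verticalLine σ / t).re := by rw [div_ofReal_re, verticalLine_re]; positivity
  have htC : (t : ℂ) ≠ 0 := by exact_mod_cast ht.ne'
  have h1 : HasDerivAt (fun t : ℝ => (t : ℂ)⁻¹) (-((t : ℂ) ^ 2)⁻¹) t :=
    (hasDerivAt_inv htC).comp_ofReal
  have h2 : HasDerivAt (fun t : ℝ => verticalLine σ / t) (verticalLine σ * -((t : ℂ) ^ 2)⁻¹) t := by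
    simpa only [div_eq_mul_inv] using h1.const_mul (verticalLine σ)
  have h3 := h1.smul ((h.hasDerivAt h0).scomp t h2)
  refine h3.congr_deriv ?_
  simp only [scaledResolvent, smul_pow, smul_sub, smul_smul, Function.comp_apply, smul_neg]
  module

theorem continuous_scaledResolvent_line (h : IsHalfPlaneResolvent R K) {t : ℝ} (ht : 0 < t) :
    Continuous fun σ => scaledResolvent R t (verticalLine σ) :=
  continuous_iff_continuousAt.2 fun σ => (h.hasDerivAt_scaledResolvent_line ht σ).continuousAt

theorem hasDerivAt_semigroupIntegrand (h : IsHalfPlaneResolvent R K) {t : ℝ} (ht : 0 < t) (σ : ℝ) :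
    HasDerivAt (fun t => semigroupIntegrand R t σ) (semigroupIntegrandDeriv R t σ) t := by
  have h1 := h.hasDerivAt_scaledResolvent_time ht σ
  have h2 := (h1.mul h1).const_smul (cexp (verticalLine σ))
  simp only [semigroupIntegrand, pow_two]
  refine h2.congr_deriv ?_
  simp only [semigroupIntegrandDeriv, pow_succ, pow_zero, one_mul, smul_mul_assoc, mul_smul_comm,
    sub_mul, mul_sub, mul_assoc]
  module

theorem continuous_semigroupIntegrand (h : IsHalfPlaneResolvent R K) {t : ℝ} (ht : 0 < t) :
    Continuous (semigroupIntegrand R t) :=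
  (continuous_exp.comp continuous_verticalLine).smul ((h.continuous_scaledResolvent_line ht).pow 2)

theorem norm_semigroupIntegrand_le (h : IsHalfPlaneResolvent R K) {t : ℝ} (ht : 0 < t) (σ : ℝ) :
    ‖semigroupIntegrand R t σ‖ ≤ Real.exp 1 * K ^ 2 * (1 + σ ^ 2)⁻¹ := by
  rw [semigroupIntegrand, norm_smul, norm_exp_verticalLine, mul_assoc, ← norm_verticalLine_sq,
    ← div_eq_mul_inv]
  gcongr
  exact h.norm_scaledResolvent_pow_le ht σ two_pos

theorem integrable_semigroupIntegrand (h : IsHalfPlaneResolvent R K) {t : ℝ} (ht : 0 < t) :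
    Integrable (semigroupIntegrand R t) :=
  integrable_of_continuous_of_norm_le (h.continuous_semigroupIntegrand ht)
    (h.norm_semigroupIntegrand_le ht)

theorem norm_scaledResolvent_cube_le (h : IsHalfPlaneResolvent R K) {t : ℝ} (ht : 0 < t) (σ : ℝ) :
    ‖verticalLine σ • scaledResolvent R t (verticalLine σ) ^ 3‖ ≤ K ^ 3 * (1 + σ ^ 2)⁻¹ := by
  have h1 := h.norm_scaledResolvent_pow_le ht σ (n := 3) (by norm_num)
  have h2 := one_le_norm_verticalLine σ
  rw [norm_smul, ← norm_verticalLine_sq]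
  calc ‖verticalLine σ‖ * ‖scaledResolvent R t (verticalLine σ) ^ 3‖
      ≤ ‖verticalLine σ‖ * (K ^ 3 / ‖verticalLine σ‖ ^ 3) := by gcongr
    _ = K ^ 3 * (‖verticalLine σ‖ ^ 2)⁻¹ := by field_simp

theorem continuous_semigroupIntegrandDeriv (h : IsHalfPlaneResolvent R K) {t : ℝ} (ht : 0 < t) :
    Continuous (semigroupIntegrandDeriv R t) :=
  (continuous_exp.comp continuous_verticalLine).smul
    (((continuous_verticalLine.smul ((h.continuous_scaledResolvent_line ht).pow 3)).sub
      ((h.continuous_scaledResolvent_line ht).pow 2)).const_smul (2 * (t : ℂ)⁻¹))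

theorem norm_semigroupIntegrandDeriv_le (h : IsHalfPlaneResolvent R K) {t : ℝ} (ht : 0 < t)
    (σ : ℝ) : ‖semigroupIntegrandDeriv R t σ‖ ≤
      Real.exp 1 * (2 * t⁻¹) * (K ^ 3 + K ^ 2) * (1 + σ ^ 2)⁻¹ := by
  have h1 := h.norm_scaledResolvent_cube_le ht σ
  have h2 := h.norm_scaledResolvent_pow_le ht σ two_pos
  rw [norm_verticalLine_sq, div_eq_mul_inv] at h2
  rw [semigroupIntegrandDeriv, norm_smul, norm_smul, norm_exp_verticalLine, norm_mul, norm_inv,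
    norm_real, Real.norm_of_nonneg ht.le, mul_assoc (_ * _), mul_assoc (Real.exp 1)]
  simp only [Complex.norm_ofNat]
  gcongr
  refine (norm_sub_le _ _).trans ?_
  rw [add_mul]
  exact add_le_add h1 h2

theorem hasDerivAt_holomorphicSemigroup [CompleteSpace 𝔄] (h : IsHalfPlaneResolvent R K) {t : ℝ}
    (ht : 0 < t) :
    Integrable (semigroupIntegrandDeriv R t) ∧ HasDerivAt (holomorphicSemigroup R)
      ((2 * Real.pi)⁻¹ • ∫ σ, semigroupIntegrandDeriv R t σ) t := by
  have hK := h.nonneg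
  have hpos : ∀ s ∈ Ioi (t / 2), 0 < s := fun s hs => (half_pos ht).trans hs
  have key := hasDerivAt_integral_of_dominated_loc_of_deriv_le (μ := volume)
    (F := semigroupIntegrand R) (F' := semigroupIntegrandDeriv R) (x₀ := t) (s := Ioi (t / 2))
    (bound := fun σ => Real.exp 1 * (2 * (t / 2)⁻¹) * (K ^ 3 + K ^ 2) * (1 + σ ^ 2)⁻¹)
    (Ioi_mem_nhds (half_lt_self ht)) ?_ (h.integrable_semigroupIntegrand ht)
    (h.continuous_semigroupIntegrandDeriv ht).aestronglyMeasurable ?_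
    (integrable_inv_one_add_sq.const_mul _) ?_
  · exact ⟨key.1, key.2.const_smul (2 * Real.pi)⁻¹⟩
  · filter_upwards [Ioi_mem_nhds ht] with s hs
    exact (h.continuous_semigroupIntegrand hs).aestronglyMeasurable
  · refine .of_forall fun σ s hs => (h.norm_semigroupIntegrandDeriv_le (hpos s hs) σ).trans ?_
    have := hpos s hs
    gcongr
    exact (mem_Ioi.1 hs).le
  · exact .of_forall fun σ s hs => h.hasDerivAt_semigroupIntegrand (hpos s hs) σ

/-- The resolvent identity between `w - t A` and `1 - A`, in the form
`w (w - t A)⁻¹ (1 - A)⁻¹ = (1 - A)⁻¹ + t (w - t A)⁻¹ A (1 - A)⁻¹`. -/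
theorem smul_scaledResolvent_mul (h : IsHalfPlaneResolvent R K) {t : ℝ} (ht : 0 < t) (σ : ℝ) :
    verticalLine σ • (scaledResolvent R t (verticalLine σ) * R 1) =
      R 1 + (t : ℂ) • (scaledResolvent R t (verticalLine σ) * (R 1 - 1)) := by
  have htC : (t : ℂ) ≠ 0 := by exact_mod_cast ht.ne'
  have h1 := h.sub_eq (verticalLine σ / t) 1
    (by rw [div_ofReal_re, verticalLine_re]; positivity) (by simp)
  rw [scaledResolvent, smul_mul_assoc, smul_mul_assoc, smul_inv_smul₀ htC, smul_smul,
    ← div_eq_mul_inv, mul_sub, mul_one]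
  rw [sub_smul, one_smul] at h1
  rw [← sub_eq_zero, ← sub_eq_zero.2 h1]
  abel

theorem commute_scaledResolvent (h : IsHalfPlaneResolvent R K) {t : ℝ} (ht : 0 < t) (σ : ℝ) :
    Commute (R 1) (scaledResolvent R t (verticalLine σ)) :=
  (show Commute (R 1) (R _) from h.mul_comm (by simp)
    (by rw [div_ofReal_re, verticalLine_re]; positivity)).smul_right _

theorem norm_holomorphicSemigroup_le (h : IsHalfPlaneResolvent R K) {t : ℝ} (ht : 0 < t) :
    ‖holomorphicSemigroup R t‖ ≤
      (2 * Real.pi)⁻¹ * ∫ σ : ℝ, Real.exp 1 * K ^ 2 * (1 + σ ^ 2)⁻¹ := by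
  rw [holomorphicSemigroup, norm_smul, Real.norm_of_nonneg (by positivity)]
  gcongr
  exact norm_integral_le_of_norm_le (integrable_inv_one_add_sq.const_mul _)
    (.of_forall (h.norm_semigroupIntegrand_le ht))

theorem commute_holomorphicSemigroup (h : IsHalfPlaneResolvent R K) {t : ℝ} (ht : 0 < t) :
    Commute (R 1) (holomorphicSemigroup R t) := by
  refine Commute.smul_right ?_ _
  have hi := h.integrable_semigroupIntegrand ht
  rw [Commute, SemiconjBy, ← integral_const_mul_of_integrable hi,
    ← integral_mul_const_of_integrable hi]
  exact integral_congr_ae (.of_forall fun σ =>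
    (((h.commute_scaledResolvent ht σ).pow_right 2).smul_right _).eq)

/-- Integration by parts, moving the derivative from `e^w` to the squared resolvent. -/
theorem integral_semigroupIntegrand (h : IsHalfPlaneResolvent R K) {t : ℝ} (ht : 0 < t) :
    Integrable (fun σ => cexp (verticalLine σ) •
      (2 : ℂ) • scaledResolvent R t (verticalLine σ) ^ 3) ∧
    ∫ σ, semigroupIntegrand R t σ =
      ∫ σ, cexp (verticalLine σ) • (2 : ℂ) • scaledResolvent R t (verticalLine σ) ^ 3 := by
  have hcQ := h.continuous_scaledResolvent_line ht
  have hint : Integrable (fun σ => cexp (verticalLine σ) •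
      (2 : ℂ) • scaledResolvent R t (verticalLine σ) ^ 3) := by
    refine integrable_of_continuous_of_norm_le (c := Real.exp 1 * (2 * K ^ 3))
      ((continuous_exp.comp continuous_verticalLine).smul ((hcQ.pow 3).const_smul _)) fun σ => ?_
    have h1 := h.norm_scaledResolvent_cube_le ht σ
    have h2 : ‖scaledResolvent R t (verticalLine σ) ^ 3‖ ≤
        ‖verticalLine σ • scaledResolvent R t (verticalLine σ) ^ 3‖ := by
      rw [norm_smul]
      exact le_mul_of_one_le_left (norm_nonneg _) (one_le_norm_verticalLine σ)
    rw [norm_smul, norm_smul, norm_exp_verticalLine, mul_assoc, mul_assoc]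
    simp only [Complex.norm_ofNat]
    gcongr
    exact h2.trans h1
  refine ⟨hint, ?_⟩
  have hi := h.integrable_semigroupIntegrand ht
  have hd : ∀ σ, HasDerivAt (semigroupIntegrand R t) (I • (semigroupIntegrand R t σ -
      cexp (verticalLine σ) • (2 : ℂ) • scaledResolvent R t (verticalLine σ) ^ 3)) σ := fun σ => by
    have h1 := h.hasDerivAt_scaledResolvent_line ht σ
    have h2 := (hasDerivAt_verticalLine σ).cexp.smul (h1.mul h1)
    have h3 : semigroupIntegrand R t = (fun σ => cexp (verticalLine σ)) •
        ((fun σ => scaledResolvent R t (verticalLine σ)) *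
          fun σ => scaledResolvent R t (verticalLine σ)) := by
      funext σ
      simp [semigroupIntegrand, pow_two]
    rw [h3]
    refine h2.congr_deriv ?_
    simp only [pow_succ, pow_zero, one_mul, smul_mul_assoc, mul_smul_comm,
      neg_mul, mul_neg, mul_assoc, Pi.mul_apply, Pi.smul_apply', smul_sub]
    module
  have h0 := integral_eq_zero_of_hasDerivAt_of_integrable hd ((hi.sub hint).smul I) hi
  rw [integral_smul, integral_sub hi hint, smul_eq_zero_iff_right I_ne_zero, sub_eq_zero] at h0
  exact h0

/-- The derivative of `e^{tA}` is `A e^{tA}`, expressed through the resolvent. -/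
theorem exists_hasDerivAt_holomorphicSemigroup [CompleteSpace 𝔄]
    (h : IsHalfPlaneResolvent R K) {t : ℝ} (ht : 0 < t) :
    ∃ V : 𝔄, HasDerivAt (holomorphicSemigroup R) V t ∧
      R 1 * V = holomorphicSemigroup R t * (R 1 - 1) := by
  obtain ⟨hi, hd⟩ := h.hasDerivAt_holomorphicSemigroup ht
  refine ⟨_, hd, ?_⟩
  have htC : (t : ℂ) ≠ 0 := by exact_mod_cast ht.ne'
  obtain ⟨hi3, h3⟩ := h.integral_semigroupIntegrand ht
  rw [holomorphicSemigroup, h3, smul_mul_assoc, mul_smul_comm,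
    ← integral_const_mul_of_integrable hi, ← integral_mul_const_of_integrable hi3]
  congr 1
  refine integral_congr_ae (.of_forall fun σ => ?_)
  have hc := h.commute_scaledResolvent ht σ
  have hw := h.smul_scaledResolvent_mul ht σ
  set Q := scaledResolvent R t (verticalLine σ) with hQ
  have h4 : R 1 * (verticalLine σ • Q ^ 3 - Q ^ 2) = (t : ℂ) • (Q ^ 3 * (R 1 - 1)) := by
    calc R 1 * (verticalLine σ • Q ^ 3 - Q ^ 2)
        = Q ^ 2 * (verticalLine σ • (Q * R 1) - R 1) := by
          rw [mul_sub, mul_smul_comm, (hc.pow_right 3).eq, (hc.pow_right 2).eq, mul_sub,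
            mul_smul_comm, ← mul_assoc, ← pow_succ]
      _ = (t : ℂ) • (Q ^ 3 * (R 1 - 1)) := by
          rw [hw, add_sub_cancel_left, mul_smul_comm, ← mul_assoc, ← pow_succ]
  change R 1 * (cexp (verticalLine σ) • (2 * (t : ℂ)⁻¹) • (verticalLine σ • Q ^ 3 - Q ^ 2)) =
    (cexp (verticalLine σ) • (2 : ℂ) • Q ^ 3) * (R 1 - 1)
  rw [mul_smul_comm, mul_smul_comm, h4, smul_mul_assoc, smul_mul_assoc, mul_smul,
    inv_smul_smul₀ htC]

/-- On the range of the resolvent, `e^{tA}` differs from the identity by `O(t)`. -/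
theorem exists_norm_holomorphicSemigroup_mul_sub_le [CompleteSpace 𝔄]
    (h : IsHalfPlaneResolvent R K) :
    ∃ c : ℝ, ∀ t : ℝ, 0 < t → ‖holomorphicSemigroup R t * R 1 - R 1‖ ≤ c * t := by
  refine ⟨(2 * Real.pi)⁻¹ * ∫ σ : ℝ, Real.exp 1 * ((K + K ^ 2) * ‖R 1 - 1‖) * (1 + σ ^ 2)⁻¹,
    fun t ht => ?_⟩
  have hi := h.integrable_semigroupIntegrand ht
  have hcw : Continuous fun σ => cexp (verticalLine σ) * ((verticalLine σ)⁻¹ ^ 2) :=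
    (continuous_exp.comp continuous_verticalLine).mul
      ((continuous_verticalLine.inv₀ verticalLine_ne_zero).pow 2)
  have hw : Integrable fun σ => cexp (verticalLine σ) * ((verticalLine σ)⁻¹ ^ 2) :=
    integrable_of_continuous_of_norm_le (c := Real.exp 1) hcw fun σ => by
      rw [norm_mul, norm_exp_verticalLine, norm_pow, norm_inv, inv_pow, norm_verticalLine_sq]
  have h1 : R 1 = (2 * Real.pi)⁻¹ •
      ∫ σ : ℝ, (cexp (verticalLine σ) * ((verticalLine σ)⁻¹ ^ 2)) • R 1 := by
    rw [integral_smul_const, ← smul_assoc, integral_exp_mul_inv_sq_verticalLine, one_smul]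
  have h2 : holomorphicSemigroup R t * R 1 - R 1 = (2 * Real.pi)⁻¹ • ∫ σ : ℝ,
      (semigroupIntegrand R t σ * R 1 -
        (cexp (verticalLine σ) * ((verticalLine σ)⁻¹ ^ 2)) • R 1) := by
    rw [integral_sub (hi.mul_const _) (hw.smul_const _), smul_sub, ← h1,
      integral_mul_const_of_integrable hi, ← smul_mul_assoc, holomorphicSemigroup]
  rw [h2, norm_smul, Real.norm_of_nonneg (by positivity), mul_assoc, ← integral_mul_const]
  gcongr
  refine norm_integral_le_of_norm_le
    ((integrable_inv_one_add_sq.const_mul _).mul_const _) (.of_forall fun σ => ?_)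
  have hwQ := h.smul_scaledResolvent_mul ht σ
  have hQ1 := h.norm_scaledResolvent_le ht σ
  have hQ2 := h.norm_scaledResolvent_pow_le ht σ two_pos
  have hw0 := verticalLine_ne_zero σ
  have hw1 := one_le_norm_verticalLine σ
  have hK := h.nonneg
  simp only [semigroupIntegrand]
  rw [← norm_verticalLine_sq]
  set Q := scaledResolvent R t (verticalLine σ)
  set w := verticalLine σ
  have h3 : Q * R 1 = w⁻¹ • (R 1 + (t : ℂ) • (Q * (R 1 - 1))) := by
    rw [← hwQ, inv_smul_smul₀ hw0]
  have h4 : Q ^ 2 * R 1 = (w⁻¹ ^ 2) • R 1 +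
      (t : ℂ) • ((w⁻¹ ^ 2) • Q + w⁻¹ • Q ^ 2) * (R 1 - 1) := by
    rw [pow_two, mul_assoc, h3, mul_smul_comm, mul_add, h3]
    simp only [mul_smul_comm, smul_mul_assoc, add_mul, smul_add, mul_assoc, pow_two, smul_smul]
    rw [add_assoc]
    module
  rw [smul_mul_assoc, h4, smul_add, smul_smul, add_sub_cancel_left, norm_smul]
  have h5 : ‖(w⁻¹ ^ 2) • Q‖ ≤ K * (‖w‖ ^ 2)⁻¹ := by
    rw [norm_smul, norm_pow, norm_inv, inv_pow, _root_.mul_comm]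
    gcongr
    exact hQ1.trans (div_le_self hK hw1)
  have h6 : ‖w⁻¹ • Q ^ 2‖ ≤ K ^ 2 * (‖w‖ ^ 2)⁻¹ := by
    rw [norm_smul, norm_inv]
    exact (mul_le_of_le_one_left (norm_nonneg _) (inv_le_one_of_one_le₀ hw1)).trans hQ2
  have h7 : ‖(t : ℂ) • ((w⁻¹ ^ 2) • Q + w⁻¹ • Q ^ 2) * (R 1 - 1)‖ ≤
      t * ((K + K ^ 2) * (‖w‖ ^ 2)⁻¹) * ‖R 1 - 1‖ := by
    refine (norm_mul_le _ _).trans ?_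
    rw [norm_smul, norm_real, Real.norm_of_nonneg ht.le, add_mul]
    gcongr
    exact (norm_add_le _ _).trans (add_le_add h5 h6)
  have h8 : ‖cexp w‖ = Real.exp 1 := norm_exp_verticalLine σ
  rw [h8]
  calc _ ≤ Real.exp 1 * (t * ((K + K ^ 2) * (‖w‖ ^ 2)⁻¹) * ‖R 1 - 1‖) := by gcongr
    _ = _ := by ring

/-- The semigroup law: `s ↦ e^{(t - s) A} e^{(r + s) A}` has derivative zero on `[0, t)`. Multiplied
by `R 1`, it has a limit in norm at `t`; this suffices because `R 1` is injective. -/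
theorem holomorphicSemigroup_add [CompleteSpace 𝔄] (h : IsHalfPlaneResolvent R K)
    (hinj : ∀ a : 𝔄, R 1 * a = 0 → a = 0) {t r : ℝ} (ht : 0 < t) (hr : 0 < r) :
    holomorphicSemigroup R (t + r) = holomorphicSemigroup R t * holomorphicSemigroup R r := by
  set T := holomorphicSemigroup R with hT
  let f : ℝ → 𝔄 := fun s => T (t - s) * T (r + s)
  have hd : ∀ s ∈ Ico 0 t, HasDerivAt f 0 s := fun s hs => by
    obtain ⟨V, hV, hV'⟩ := h.exists_hasDerivAt_holomorphicSemigroup (sub_pos.2 hs.2)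
    obtain ⟨W, hW, hW'⟩ := h.exists_hasDerivAt_holomorphicSemigroup
      (show 0 < r + s by linarith [hs.1])
    have h1 := (hV.scomp s ((hasDerivAt_id s).const_sub t)).mul
      (hW.scomp s ((hasDerivAt_id s).const_add r))
    refine h1.congr_deriv (hinj _ ?_)
    have hc := h.commute_holomorphicSemigroup (sub_pos.2 hs.2)
    have hc' := h.commute_holomorphicSemigroup (show 0 < r + s by linarith [hs.1])
    simp only [Function.comp_apply, neg_smul, one_smul, mul_add, neg_mul, mul_neg]
    rw [← mul_assoc, hV', ← mul_assoc (R 1), hc.eq, mul_assoc _ (R 1), hW', mul_assoc,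
      sub_mul, mul_sub, hc'.eq, one_mul]
    simp [mul_sub]
  have hconst : ∀ s ∈ Ico 0 t, f s = f 0 := fun s hs =>
    constant_of_derivWithin_zero (f := f) (a := 0) (b := s)
      (fun x hx => (hd x ⟨hx.1, hx.2.trans_lt hs.2⟩).differentiableAt.differentiableWithinAt)
      (fun x hx => ((hd x ⟨hx.1, hx.2.trans hs.2⟩).hasDerivWithinAt).derivWithin
        (uniqueDiffOn_Icc (hx.1.trans_lt hx.2) x ⟨hx.1, hx.2.le⟩)) s ⟨hs.1, le_rfl⟩
  obtain ⟨c, hc⟩ := h.exists_norm_holomorphicSemigroup_mul_sub_le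
  -- the limit as `s` tends to `t`
  have h1 : Tendsto (fun s => T (t - s) * R 1) (𝓝[<] t) (𝓝 (R 1)) := by
    rw [tendsto_iff_norm_sub_tendsto_zero]
    have h2 : Tendsto (fun s => c * (t - s)) (𝓝[<] t) (𝓝 0) :=
      tendsto_nhdsWithin_of_tendsto_nhds (Continuous.tendsto' (by fun_prop) _ _ (by simp))
    refine squeeze_zero' (.of_forall fun _ => norm_nonneg _) ?_ h2
    filter_upwards [self_mem_nhdsWithin] with s hs using hc _ (sub_pos.2 hs)
  have h2 : Tendsto (fun s => T (r + s)) (𝓝[<] t) (𝓝 (T (r + t))) := by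
    obtain ⟨W, hW, -⟩ := h.exists_hasDerivAt_holomorphicSemigroup (add_pos hr ht)
    exact tendsto_nhdsWithin_of_tendsto_nhds
      (hW.continuousAt.tendsto.comp (Continuous.tendsto' (by fun_prop) _ _ rfl))
  have h3 : Tendsto (fun s => R 1 * f s) (𝓝[<] t) (𝓝 (R 1 * T (r + t))) := by
    refine (h1.mul h2).congr' ?_
    filter_upwards [self_mem_nhdsWithin] with s hs
    rw [← mul_assoc, (h.commute_holomorphicSemigroup (sub_pos.2 hs)).eq]
  have h4 : Tendsto (fun s => R 1 * f s) (𝓝[<] t) (𝓝 (R 1 * f 0)) := by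
    refine tendsto_const_nhds.congr' ?_
    filter_upwards [Ioo_mem_nhdsLT ht] with s hs
    rw [hconst s ⟨hs.1.le, hs.2⟩]
  have h5 := tendsto_nhds_unique h3 h4
  rw [← sub_eq_zero, ← mul_sub] at h5
  have h6 := sub_eq_zero.1 (hinj _ h5)
  simpa [f, add_comm] using h6

end IsHalfPlaneResolvent

end InverseLaplace

/-! ### Sectorial operators generate semigroups -/

section Generation

variable {X : Type*} [NormedAddCommGroup X] [NormedSpace ℂ X] {A : X →ₗ.[ℂ] X}

theorem IsResolvent.mem_graph {z : ℂ} {R : X →L[ℂ] X} (hR : IsResolvent A z R) (x : X) :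
    (R x, z • R x - x) ∈ A.graph := by
  obtain ⟨h, h'⟩ := hR.1 x
  refine A.mem_graph_iff.2 ⟨⟨_, h⟩, rfl, ?_⟩
  rw [eq_sub_iff_add_eq, ← eq_sub_iff_add_eq']
  exact h'.symm

theorem IsResolvent.sub_eq {z w : ℂ} {R S : X →L[ℂ] X} (hR : IsResolvent A z R)
    (hS : IsResolvent A w S) : R - S = (w - z) • (R * S) := by
  ext x
  obtain ⟨h, h'⟩ := hS.1 x
  have h1 : R (z • S x - A ⟨S x, h⟩) = S x := hR.2 ⟨S x, h⟩
  have h2 : z • S x - A ⟨S x, h⟩ = x - (w - z) • S x := by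
    linear_combination (norm := module) h'
  rw [h2, map_sub, map_smul] at h1
  simp only [sub_apply, smul_apply, mul_apply_eq_comp]
  linear_combination (norm := module) h1

theorem IsResolvent.injective {z : ℂ} {R : X →L[ℂ] X} (hR : IsResolvent A z R) :
    Function.Injective R := by
  refine (injective_iff_map_eq_zero R).2 fun x hx => ?_
  obtain ⟨h, h'⟩ := hR.1 x
  have h1 : (⟨R x, h⟩ : A.domain) = 0 := Subtype.ext hx
  rw [h1, hx] at h'
  simpa using h'.symm

/-- The resolvents of a sectorial operator on a right half plane. -/
theorem IsSectorial.exists_isHalfPlaneResolvent (hA : IsSectorial A) :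
    ∃ (ω K : ℝ) (R : ℂ → X →L[ℂ] X), IsHalfPlaneResolvent R K ∧
      ∀ z : ℂ, 0 < z.re → IsResolvent A (ω + z) (R z) := by
  obtain ⟨-, ω, θ, K, hθ, h⟩ := hA
  have hsec : ∀ z : ℂ, 0 < z.re → z ∈ sector θ := fun z hz =>
    ⟨‖z‖, z.arg, norm_pos_iff.2 (by rintro rfl; simp at hz),
      (Complex.abs_arg_lt_pi_div_two_iff.2 (.inl hz)).trans hθ,
      (Complex.norm_mul_exp_arg_mul_I z).symm⟩
  have h' : ∀ z : ℂ, ∃ R : X →L[ℂ] X, 0 < z.re → IsResolvent A (ω + z) R ∧ ‖R‖ ≤ K / ‖z‖ :=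
    fun z => by
      by_cases hz : 0 < z.re
      · obtain ⟨R, hR⟩ := h (ω + z) (by simpa using hsec z hz)
        exact ⟨R, fun _ => by simpa using hR⟩
      · exact ⟨0, fun hz' => absurd hz' hz⟩
  choose R hR using h'
  refine ⟨ω, K, R, ⟨fun z w hz hw => ?_, fun z hz => (hR z hz).2⟩, fun z hz => (hR z hz).1⟩
  rw [(hR z hz).1.sub_eq (hR w hw).1, add_sub_add_left_eq_sub]

variable [CompleteSpace X]

/-- The semigroup of operators `e^{ω t} holomorphicSemigroup R t`. At `t = 0`, where
`holomorphicSemigroup` has a junk value, the identity is prescribed. -/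
def IsHalfPlaneResolvent.c0Semigroup {R : ℂ → X →L[ℂ] X} {K : ℝ} (h : IsHalfPlaneResolvent R K)
    (ω : ℝ) (hinj : Function.Injective (R 1)) (hdense : DenseRange (R 1)) : C0Semigroup X where
  op t := if t = 0 then 1 else Real.exp (ω * t) • holomorphicSemigroup R t
  op_zero := if_pos rfl
  op_add s t := by
    rcases eq_or_ne s 0 with rfl | hs
    · rw [zero_add, if_pos rfl]; rfl
    rcases eq_or_ne t 0 with rfl | ht
    · rw [add_zero, if_pos rfl]; rfl
    have hst : s + t ≠ 0 := by positivity
    rw [if_neg hs, if_neg ht, if_neg hst, NNReal.coe_add, h.holomorphicSemigroup_add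
      (fun a ha => ContinuousLinearMap.ext fun x => hinj (by
        rw [zero_apply, map_zero]; exact DFunLike.congr_fun ha x))
      (NNReal.coe_pos.2 (pos_iff_ne_zero.2 hs)) (NNReal.coe_pos.2 (pos_iff_ne_zero.2 ht)),
      mul_add, Real.exp_add]
    exact (smul_mul_smul_comm _ _ _ _).symm
  continuous_op x := by
    let S : ℝ≥0 → X →L[ℂ] X := fun t => if t = 0 then 1 else holomorphicSemigroup R t
    suffices hS : Continuous fun t => S t x by
      have h1 : Continuous fun t : ℝ≥0 => Real.exp (ω * t) • S t x := by fun_prop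
      refine h1.congr fun t => ?_
      rcases eq_or_ne t 0 with rfl | ht
      · simp [S]
      · simp [S, ht]
    obtain ⟨c, hc⟩ := h.exists_norm_holomorphicSemigroup_mul_sub_le
    set C := (2 * Real.pi)⁻¹ * ∫ σ : ℝ, Real.exp 1 * K ^ 2 * (1 + σ ^ 2)⁻¹ with hC
    have hSle : ∀ t, ‖S t‖ ≤ max C 1 := fun t => by
      rcases eq_or_ne t 0 with rfl | ht
      · simpa [S] using .inr ContinuousLinearMap.norm_id_le
      · simp only [S, if_neg ht]
        exact (h.norm_holomorphicSemigroup_le (NNReal.coe_pos.2 (pos_iff_ne_zero.2 ht))).trans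
          (le_max_left _ _)
    have hSR : ∀ y, Tendsto (fun t => S t (R 1 y)) (𝓝 0) (𝓝 (R 1 y)) := fun y => by
      rw [tendsto_iff_norm_sub_tendsto_zero]
      have h2 : Tendsto (fun t : ℝ≥0 => c * t * ‖y‖) (𝓝 0) (𝓝 0) :=
        Continuous.tendsto' (by fun_prop) _ _ (by simp)
      refine squeeze_zero (fun _ => norm_nonneg _) (fun t => ?_) h2
      rcases eq_or_ne t 0 with rfl | ht
      · simp [S]
      · simp only [S, if_neg ht]
        exact (holomorphicSemigroup R t * R 1 - R 1).le_of_opNorm_le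
          (hc _ (NNReal.coe_pos.2 (pos_iff_ne_zero.2 ht))) y
    refine continuous_iff_continuousAt.2 fun t => ?_
    rcases eq_or_ne t 0 with rfl | ht
    · -- the bound for `S` extends convergence from the dense range of `R 1` to all of `X`
      have h0 : S 0 x = x := by simp [S]
      rw [ContinuousAt, h0, Metric.tendsto_nhds]
      intro ε hε
      have hM : 0 < max C 1 := lt_max_of_lt_right one_pos
      obtain ⟨y, hy⟩ := hdense.exists_dist_lt x (ε := ε / (2 * (max C 1 + 1))) (by positivity)
      rw [lt_div_iff₀ (by positivity), dist_eq_norm] at hy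
      filter_upwards [Metric.tendsto_nhds.1 (hSR y) (ε / 2) (half_pos hε)] with t ht
      rw [dist_eq_norm] at ht ⊢
      have e : S t x - x = S t (x - R 1 y) + ((S t (R 1 y) - R 1 y) - (x - R 1 y)) := by
        rw [map_sub]; abel
      have h1 := (S t).le_of_opNorm_le (hSle t) (x - R 1 y)
      calc ‖S t x - x‖ ≤ ‖S t (x - R 1 y)‖ + (‖S t (R 1 y) - R 1 y‖ + ‖x - R 1 y‖) := by
            rw [e]
            exact (norm_add_le _ _).trans (by gcongr; exact norm_sub_le _ _)
        _ < ε := by linarith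
    · have htpos : 0 < (t : ℝ) := NNReal.coe_pos.2 (pos_iff_ne_zero.2 ht)
      obtain ⟨V, hV, -⟩ := h.exists_hasDerivAt_holomorphicSemigroup htpos
      have h1 : ContinuousAt (fun s : ℝ≥0 => holomorphicSemigroup R s x) t :=
        (hV.continuousAt.comp NNReal.continuous_coe.continuousAt).clm_apply continuousAt_const
      refine h1.congr ?_
      filter_upwards [isOpen_ne.mem_nhds ht] with s hs
      simp [S, show s ≠ 0 from hs]

/-- On the range of the resolvent, the semigroup is differentiable for positive time. -/
theorem IsHalfPlaneResolvent.hasDerivAt_c0Semigroup {R : ℂ → X →L[ℂ] X} {K : ℝ}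
    (h : IsHalfPlaneResolvent R K) (ω : ℝ) (hinj : Function.Injective (R 1))
    (hdense : DenseRange (R 1)) (y : X) {t : ℝ} (ht : 0 < t) :
    HasDerivAt (fun s : ℝ => (h.c0Semigroup ω hinj hdense).op s.toNNReal (R 1 y))
      ((h.c0Semigroup ω hinj hdense).op t.toNNReal (((ω : ℂ) + 1) • R 1 y - y)) t := by
  have hop : ∀ s : ℝ, 0 < s → (h.c0Semigroup ω hinj hdense).op s.toNNReal =
      Real.exp (ω * s) • holomorphicSemigroup R s := fun s hs => by
    have : s.toNNReal ≠ 0 := (Real.toNNReal_pos.2 hs).ne'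
    simp only [IsHalfPlaneResolvent.c0Semigroup, if_neg this, Real.coe_toNNReal _ hs.le]
  obtain ⟨V, hV, hV'⟩ := h.exists_hasDerivAt_holomorphicSemigroup ht
  have h1 : HasDerivAt (fun s => R 1 (holomorphicSemigroup R s y)) (R 1 (V y)) t :=
    (R 1).hasFDerivAt.restrictScalars ℝ |>.comp_hasDerivAt t
      (((ContinuousLinearMap.apply ℂ X y).hasFDerivAt.restrictScalars ℝ).comp_hasDerivAt t hV)
  have h2 : HasDerivAt (fun s => Real.exp (ω * s)) (Real.exp (ω * t) * (ω * 1)) t :=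
    ((hasDerivAt_id t).const_mul ω).exp
  have h3 := h2.smul h1
  have hc := h.commute_holomorphicSemigroup ht
  refine (h3.congr_of_eventuallyEq ?_).congr_deriv ?_
  · filter_upwards [Ioi_mem_nhds ht] with s hs
    rw [hop s hs]
    exact congrArg (Real.exp (ω * s) • ·)
      (DFunLike.congr_fun (h.commute_holomorphicSemigroup hs).eq y).symm
  · have e1 : R 1 (V y) = holomorphicSemigroup R t (R 1 y) - holomorphicSemigroup R t y := by
      simpa using DFunLike.congr_fun hV' y
    have e2 : R 1 (holomorphicSemigroup R t y) = holomorphicSemigroup R t (R 1 y) :=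
      DFunLike.congr_fun hc.eq y
    rw [hop t ht, e1, e2]
    simp only [smul_apply, map_sub, map_smul, mul_one]
    rw [← Complex.coe_smul, ← Complex.coe_smul, ← Complex.coe_smul]
    generalize Real.exp (ω * t) = c
    simp only [Complex.ofReal_mul]
    module

theorem IsHalfPlaneResolvent.isGenerator_c0Semigroup {R : ℂ → X →L[ℂ] X} {K : ℝ}
    (h : IsHalfPlaneResolvent R K) {ω : ℝ} (hR : IsResolvent A (ω + 1) (R 1))
    (hdense : DenseRange (R 1)) : IsGenerator A (h.c0Semigroup ω hR.injective hdense) := by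
  set Φ := h.c0Semigroup ω hR.injective hdense with hΦ
  have hcoe : Tendsto (fun t : ℝ≥0 => (t : ℝ)) (𝓝[>] 0) (𝓝[>] 0) :=
    tendsto_nhdsWithin_iff.2 ⟨tendsto_nhdsWithin_of_tendsto_nhds
      (NNReal.continuous_coe.tendsto' _ _ rfl), by
        filter_upwards [self_mem_nhdsWithin] with t ht using NNReal.coe_pos.2 ht⟩
  have key : ∀ y, Tendsto (fun t : ℝ≥0 => (t : ℝ)⁻¹ • (Φ.op t (R 1 y) - Φ.op 0 (R 1 y)))
      (𝓝[>] 0) (𝓝 (((ω : ℂ) + 1) • R 1 y - y)) := fun y => by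
    have hd : ∀ t : ℝ, 0 < t → HasDerivAt (fun s : ℝ => Φ.op s.toNNReal (R 1 y))
        (Φ.op t.toNNReal (((ω : ℂ) + 1) • R 1 y - y)) t := fun t ht =>
      h.hasDerivAt_c0Semigroup ω hR.injective hdense y ht
    have hc : ∀ z, Continuous fun s : ℝ => Φ.op s.toNNReal z := fun z =>
      (Φ.continuous_op z).comp continuous_real_toNNReal
    have h1 : HasDerivWithinAt (fun s : ℝ => Φ.op s.toNNReal (R 1 y))
        (((ω : ℂ) + 1) • R 1 y - y) (Ici 0) 0 := by
      refine hasDerivWithinAt_Ici_of_tendsto_deriv (s := Ioi 0)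
        (fun t ht => (hd t ht).differentiableAt.differentiableWithinAt)
        (hc _).continuousWithinAt self_mem_nhdsWithin ?_
      refine Tendsto.congr' (f₁ := fun t : ℝ => Φ.op t.toNNReal (((ω : ℂ) + 1) • R 1 y - y)) ?_
        (tendsto_nhdsWithin_of_tendsto_nhds ((hc _).tendsto' _ _ (by simp [Φ.op_zero_apply])))
      filter_upwards [self_mem_nhdsWithin] with t ht using (hd t ht).deriv.symm
    rw [← hasDerivWithinAt_Ioi_iff_Ici, hasDerivWithinAt_iff_tendsto_slope' (by simp)] at h1
    refine (h1.comp hcoe).congr fun t => ?_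
    simp [slope]
  refine fun x y => ⟨fun hxy => ?_, fun hlim => ?_⟩
  · obtain ⟨⟨x, hx⟩, rfl, rfl⟩ := A.mem_graph_iff.1 hxy
    have h1 := key (((ω : ℂ) + 1) • x - A ⟨x, hx⟩)
    rw [← hR.eq_apply hx] at h1
    simpa only [sub_sub_cancel] using h1
  · -- apply the resolvent to the difference quotients
    have h1 := ((R 1).continuous.tendsto y).comp hlim
    have hcomm : ∀ t, R 1 (Φ.op t x) = Φ.op t (R 1 x) := fun t => by
      rcases eq_or_ne t 0 with rfl | ht
      · simp [Φ.op_zero_apply]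
      · have hc := h.commute_holomorphicSemigroup (NNReal.coe_pos.2 (pos_iff_ne_zero.2 ht))
        have : Φ.op t = Real.exp (ω * t) • holomorphicSemigroup R t := if_neg ht
        rw [this, smul_apply, smul_apply, ContinuousLinearMap.map_smul_of_tower]
        exact congrArg _ (DFunLike.congr_fun hc.eq x)
    have h2 := tendsto_nhds_unique (h1.congr fun t => by
      simp only [Function.comp_apply, ContinuousLinearMap.map_smul_of_tower, map_sub, hcomm])
      (key x)
    obtain ⟨hx, hA⟩ := hR.exists_apply_eq (x := x) (y := y) (by rw [map_sub, map_smul, h2]; abel)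
    exact A.mem_graph_iff.2 ⟨⟨x, hx⟩, rfl, hA⟩

/-- A sectorial operator generates a strongly continuous semigroup; since the semigroup maps into
the domain, its operator at time `1` factors through a resolvent. -/
theorem IsSectorial.exists_isGenerator (hA : IsSectorial A) :
    ∃ Φ : C0Semigroup X, IsGenerator A Φ ∧
      ∃ (z : ℂ) (R L : X →L[ℂ] X), IsResolvent A z R ∧ Φ.op 1 = R.comp L := by
  obtain ⟨ω, K, R, h, hR⟩ := hA.exists_isHalfPlaneResolvent
  have hR1 : IsResolvent A (ω + 1) (R 1) := hR 1 (by simp)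
  have hdense : DenseRange (R 1) := hA.1.mono fun x hx => ⟨_, (hR1.eq_apply hx).symm⟩
  refine ⟨h.c0Semigroup ω hR1.injective hdense, h.isGenerator_c0Semigroup hR1 hdense,
    ω + 1, R 1, ?_⟩
  obtain ⟨V, -, hV⟩ := h.exists_hasDerivAt_holomorphicSemigroup one_pos
  have hc := h.commute_holomorphicSemigroup one_pos
  refine ⟨Real.exp ω • (holomorphicSemigroup R 1 - V), hR1, ?_⟩
  have e : R 1 * (holomorphicSemigroup R 1 - V) = holomorphicSemigroup R 1 := by
    rw [mul_sub, hV, hc.eq, mul_sub, mul_one, sub_sub_cancel]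
  change (if (1 : ℝ≥0) = 0 then _ else _) = R 1 * (Real.exp ω • (holomorphicSemigroup R 1 - V))
  rw [if_neg one_ne_zero, mul_smul_comm, e, NNReal.coe_one, mul_one]

end Generation

/-! ### Generalized eigenvectors and the generator -/

section GeneralizedEigenvectors

open Module End

variable {X Y : Type*} [NormedAddCommGroup X] [NormedSpace ℂ X]
  [AddCommGroup Y] [Module ℂ Y] [TopologicalSpace Y]
  {A : X →ₗ.[ℂ] X} {Φ : C0Semigroup X} {C : X →L[ℂ] Y}

theorem mem_unobservableSubspace {v : X} :
    v ∈ unobservableSubspace Φ C ↔ ∀ t, C (Φ.op t v) = 0 := by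
  obtain ⟨⟨hker, hinv⟩, hub⟩ := isGreatest_unobservableSubspace Φ C
  refine ⟨fun hv t => hker _ (hinv t v hv), fun hv => ?_⟩
  let V : Submodule ℂ X := ⨅ t, LinearMap.ker (C ∘L Φ.op t : X →ₗ[ℂ] Y)
  have hV : ∀ {w}, w ∈ V ↔ ∀ t, C (Φ.op t w) = 0 := fun {w} => by simp [V]
  exact hub ⟨fun w hw => by simpa [Φ.op_zero_apply] using hV.1 hw 0,
    fun t w hw => hV.2 fun s => by rw [← Φ.op_add_apply]; exact hV.1 hw _⟩ (hV.2 hv)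

/-- The powers of `Φ 1 - λ` commute with the generator. -/
theorem IsGenerator.sub_pow_mem_graph (h : IsGenerator A Φ) (lam : ℂ) {x y : X}
    (hxy : (x, y) ∈ A.graph) (n : ℕ) :
    ((((Φ.op 1 : End ℂ X) - lam • (1 : End ℂ X)) ^ n) x,
      (((Φ.op 1 : End ℂ X) - lam • (1 : End ℂ X)) ^ n) y) ∈ A.graph := by
  induction n with
  | zero => simpa using hxy
  | succ n ih =>
    rw [pow_succ', Module.End.mul_apply, Module.End.mul_apply]
    exact A.graph.sub_mem (h.op_mem_graph ih 1) (A.graph.smul_mem lam ih)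

/-- `A` maps the kernel of the product into itself, so that `A` can be iterated on it. -/
theorem ProductAnnihilates.exists_apply {l : List ℂ} {v : X} (hv : ProductAnnihilates A l v) :
    ∃ h : v ∈ A.domain, ProductAnnihilates A l (A ⟨v, h⟩) := by
  induction l generalizing v with
  | nil =>
    obtain rfl : v = 0 := hv
    exact ⟨A.domain.zero_mem, A.map_zero⟩
  | cons μ l ih =>
    obtain ⟨h, hw⟩ := hv
    obtain ⟨h', hAw⟩ := ih hw
    set w := μ • v - A ⟨v, h⟩ with hw_def
    have hAv : A ⟨v, h⟩ = μ • v - w := by rw [hw_def, sub_sub_cancel]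
    have hd : A ⟨v, h⟩ ∈ A.domain := hAv ▸ A.domain.sub_mem (A.domain.smul_mem μ h) h'
    refine ⟨h, hd, ?_⟩
    have e : (⟨A ⟨v, h⟩, hd⟩ : A.domain) = μ • ⟨v, h⟩ - ⟨w, h'⟩ := Subtype.ext hAv
    have e' : μ • A ⟨v, h⟩ - A ⟨A ⟨v, h⟩, hd⟩ = A ⟨w, h'⟩ := by
      rw [e, A.map_sub, A.map_smul, sub_sub_cancel]
    rwa [e']

variable [CompleteSpace X]

/-- The spectral mapping for products `(μ_m - A) ⋯ (μ_1 - A)` with `e^{μ_j} = λ`: the vectors they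
annihilate are generalized eigenvectors of `Φ 1` for `λ`. -/
theorem IsGenerator.mem_maxGenEigenspace_of_productAnnihilates (h : IsGenerator A Φ)
    {lam : ℂ} {l : List ℂ} (hl : ∀ z ∈ l, Complex.exp z = lam) {v : X}
    (hv : ProductAnnihilates A l v) :
    v ∈ maxGenEigenspace (Φ.op 1 : End ℂ X) lam := by
  induction l generalizing v with
  | nil =>
    obtain rfl : v = 0 := hv
    exact Submodule.zero_mem _
  | cons μ l ih =>
    obtain ⟨hd, hw⟩ := hv
    obtain ⟨n, hn⟩ := (mem_maxGenEigenspace _ _ _).1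
      (ih (fun z hz => hl z (List.mem_cons_of_mem _ hz)) hw)
    refine (mem_maxGenEigenspace _ _ _).2 ⟨n + 1, ?_⟩
    have h1 := h.sub_pow_mem_graph lam (A.mem_graph ⟨v, hd⟩) n
    -- `(Φ 1 - λ) ^ n v` is an eigenvector of `A` for `μ`
    rw [map_sub, map_smul, sub_eq_zero] at hn
    rw [← hn] at h1
    have h2 := h.op_eq_exp_smul h1 1
    rw [pow_succ', Module.End.mul_apply, LinearMap.sub_apply, LinearMap.smul_apply,
      Module.End.one_apply, ContinuousLinearMap.coe_coe, h2, NNReal.coe_one, Complex.ofReal_one,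
      mul_one, hl μ List.mem_cons_self, sub_self]

/-- If `Φ 1` maps into the domain of `A`, then the vectors of a finite-dimensional generalized
eigenspace of `Φ 1` for `λ ≠ 0` are annihilated by a product `(μ_m - A) ⋯ (μ_1 - A)` with
`e^{μ_j} = λ`: the `μ_j` are the roots of the minimal polynomial of `A` on this eigenspace. -/
theorem IsGenerator.exists_productAnnihilates (h : IsGenerator A Φ)
    (hdom : ∀ x, Φ.op 1 x ∈ A.domain) {lam : ℂ} (hlam : lam ≠ 0)
    [FiniteDimensional ℂ (maxGenEigenspace (Φ.op 1 : End ℂ X) lam)] {v : X}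
    (hv : v ∈ maxGenEigenspace (Φ.op 1 : End ℂ X) lam) :
    ∃ l : List ℂ, (∀ z ∈ l, Complex.exp z = lam) ∧ ProductAnnihilates A l v := by
  set E := maxGenEigenspace (Φ.op 1 : End ℂ X) lam with hE
  let S : End ℂ X := (Φ.op 1 : End ℂ X) - lam • (1 : End ℂ X)
  have hEdom : ∀ w ∈ E, w ∈ A.domain := fun w hw => by
    obtain ⟨n, hn⟩ := (mem_maxGenEigenspace _ _ _).1 hw
    change (S ^ n) w = 0 at hn
    clear hw
    induction n generalizing w with
    | zero => rw [show w = 0 from hn]; exact A.domain.zero_mem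
    | succ n ih =>
      have h1 := ih (S w) (by rwa [← Module.End.mul_apply, ← pow_succ])
      have h2 : w = lam⁻¹ • (Φ.op 1 w - S w) := by simp [S, hlam]
      rw [h2]
      exact A.domain.smul_mem _ (A.domain.sub_mem (hdom w) h1)
  have hEinv : ∀ w (hw : w ∈ E), A ⟨w, hEdom w hw⟩ ∈ E := fun w hw => by
    obtain ⟨n, hn⟩ := (mem_maxGenEigenspace _ _ _).1 hw
    refine (mem_maxGenEigenspace _ _ _).2 ⟨n, ?_⟩
    have h1 := h.sub_pow_mem_graph lam (A.mem_graph ⟨w, hEdom w hw⟩) n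
    exact A.graph_fst_eq_zero_snd h1 hn
  let T : End ℂ E :=
    { toFun := fun w => ⟨A ⟨w, hEdom w w.2⟩, hEinv w w.2⟩
      map_add' := fun a b => Subtype.ext (A.map_add ⟨a, hEdom a a.2⟩ ⟨b, hEdom b b.2⟩)
      map_smul' := fun c a => Subtype.ext (A.map_smul c ⟨a, hEdom a a.2⟩) }
  have hprod : ∀ (l : List ℂ) (w : E), (l.map fun μ => T - algebraMap ℂ (End ℂ E) μ).prod w = 0 →
      ProductAnnihilates A l w := fun l => by
    induction l with
    | nil => intro w hw; exact congrArg Subtype.val hw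
    | cons μ l ih =>
      intro w hw
      refine ⟨hEdom w w.2, ?_⟩
      have hc : Commute (T - algebraMap ℂ (End ℂ E) μ)
          (l.map fun μ => T - algebraMap ℂ (End ℂ E) μ).prod := by
        refine Commute.list_prod_right _ _ fun g hg => ?_
        obtain ⟨ν, -, rfl⟩ := List.mem_map.1 hg
        exact ((Commute.refl T).sub_right (Algebra.commutes ν T).symm).sub_left
          ((show Commute _ T from Algebra.commutes μ T).sub_right (Algebra.commutes μ _))
      rw [List.map_cons, List.prod_cons, hc.eq, Module.End.mul_apply] at hw
      have h1 := ih (-((T - algebraMap ℂ (End ℂ E) μ) w)) (by rw [map_neg, hw, neg_zero])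
      rwa [LinearMap.sub_apply, neg_sub] at h1
  have hsplit := IsAlgClosed.splits (minpoly ℂ T)
  have hmonic := minpoly.monic (Algebra.IsIntegral.isIntegral (R := ℂ) T)
  refine ⟨(minpoly ℂ T).roots.toList, fun z hz => ?_, hprod _ ⟨v, hv⟩ ?_⟩
  · have hroot := (Polynomial.mem_roots'.1 (Multiset.mem_toList.1 hz)).2
    obtain ⟨w, hw⟩ := (Module.End.hasEigenvalue_of_isRoot hroot).exists_hasEigenvector
    have hw0 : (w : X) ≠ 0 := fun h0 => hw.2 (Subtype.ext h0)
    have h1 : A ⟨w, hEdom w w.2⟩ = z • (w : X) := congrArg Subtype.val hw.apply_eq_smul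
    have h2 := A.mem_graph ⟨w, hEdom w w.2⟩
    rw [h1] at h2
    have h3 := h.op_eq_exp_smul h2 1
    simp only [NNReal.coe_one, Complex.ofReal_one, mul_one] at h3
    obtain ⟨n, hn⟩ := (mem_maxGenEigenspace _ _ _).1 w.2
    have h4 : ∀ k, (((Φ.op 1 : End ℂ X) - lam • (1 : End ℂ X)) ^ k) (w : X) =
        (Complex.exp z - lam) ^ k • (w : X) := fun k => by
      induction k with
      | zero => simp
      | succ k ih =>
        rw [pow_succ', Module.End.mul_apply, ih, map_smul, LinearMap.sub_apply,
          LinearMap.smul_apply, Module.End.one_apply, ContinuousLinearMap.coe_coe, h3, ← sub_smul,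
          smul_smul, pow_succ]
    rw [h4, smul_eq_zero_iff_left hw0] at hn
    exact sub_eq_zero.1 (IsReduced.eq_zero _ ⟨n, hn⟩)
  · have h1 : minpoly ℂ T = ((minpoly ℂ T).roots.toList.map
        fun μ => Polynomial.X - Polynomial.C μ).prod := by
      conv_lhs => rw [hsplit.eq_prod_roots_of_monic hmonic]
      rw [← Multiset.prod_coe, ← Multiset.map_coe, Multiset.coe_toList]
    have h2 := minpoly.aeval ℂ T
    rw [h1, map_list_prod, List.map_map] at h2
    have h3 : (⇑(Polynomial.aeval T) ∘ fun μ : ℂ => Polynomial.X - Polynomial.C μ) =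
        fun μ => T - algebraMap ℂ (End ℂ E) μ := by
      funext μ
      simp
    rw [h3] at h2
    rw [h2, LinearMap.zero_apply]

end GeneralizedEigenvectors

/-! ### Stability -/

section Stability

open Module End

variable {X U Y : Type*} [NormedAddCommGroup X] [NormedSpace ℂ X]
  [AddCommGroup U] [Module ℂ U] [UniformSpace U] [AddCommGroup Y] [Module ℂ Y] [UniformSpace Y]
  {A : X →ₗ.[ℂ] X} {Φ : C0Semigroup X} {B : U →L[ℂ] X} {C : X →L[ℂ] Y} {D : U →L[ℂ] Y}

/-- The orbit of a vector annihilated by a product `(μ_m - A) ⋯ (μ_1 - A)` is a smooth trajectory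
for the zero input. -/
theorem IsGenerator.zero_orbit_mem_cauchyRelation [CompleteSpace X] [FrechetSpace U]
    [FrechetSpace Y] (h : IsGenerator A Φ) {l : List ℂ} {v : X}
    (hv : ProductAnnihilates A l v) :
    ((0 : ℝ≥0 → U), fun t => C (Φ.op t v)) ∈ cauchyRelation A B C D := by
  have := FrechetSpace.continuousSMul_real (E := U)
  have := FrechetSpace.continuousSMul_real (E := Y)
  let next : {w // ProductAnnihilates A l w} → {w // ProductAnnihilates A l w} :=
    fun w => ⟨A ⟨w, w.2.exists_apply.1⟩, w.2.exists_apply.2⟩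
  let a : ℕ → {w // ProductAnnihilates A l w} := fun k => next^[k] ⟨v, hv⟩
  have ha : ∀ k, ((a k : X), (a (k + 1) : X)) ∈ A.graph := fun k => by
    simp only [a, Function.iterate_succ_apply']
    exact A.mem_graph ⟨_, (next^[k] ⟨v, hv⟩).2.exists_apply.1⟩
  have hx : ∀ k t, HasTimeDeriv (fun s => Φ.op s (a k : X)) (Φ.op t (a (k + 1) : X)) t :=
    fun k t => h.hasTimeDeriv_op (ha k) t
  refine ⟨isSmooth_zero, isSmooth_of_seq (g := fun k t => C (Φ.op t (a k : X)))
    fun k t => (hx k t).clm_comp C, fun t => Φ.op t v,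
    isSmooth_of_seq (g := fun k t => Φ.op t (a k : X)) hx, fun t => ?_, fun t => by simp⟩
  obtain ⟨w, hw, hAw⟩ := A.mem_graph_iff.1 (h.op_mem_graph (ha 0) t)
  have e : Φ.op t v = w := hw.symm
  have hmem : Φ.op t v ∈ A.domain := e ▸ w.2
  refine ⟨hmem, ?_⟩
  have e2 : (⟨Φ.op t v, hmem⟩ : A.domain) = w := Subtype.ext e
  rw [e2, hAw, (show timeDeriv (fun t => Φ.op t v) t = _ from (hx 0 t).timeDeriv_eq)]
  simp

/-- A generalized eigenvector of `Φ 1` outside the open unit disc with vanishing output has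
zero output, by induction on the length of its Jordan chain. -/
theorem output_eq_zero_of_vanishes [FrechetSpace Y] {lam : ℂ} (hlam : 1 ≤ ‖lam‖) (n : ℕ) {v : X}
    (hn : (((Φ.op 1 : End ℂ X) - lam • (1 : End ℂ X)) ^ n) v = 0)
    (hv : Vanishes fun t => C (Φ.op t v)) (t : ℝ≥0) : C (Φ.op t v) = 0 := by
  induction n generalizing v t with
  | zero =>
    rw [show v = 0 from hn]
    simp
  | succ n ih =>
    rw [pow_succ, Module.End.mul_apply] at hn
    obtain ⟨p, hp⟩ := FrechetSpace.exists_withSeminorms (E := Y)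
    have : ContinuousSMul ℂ Y := hp.continuousSMul
    have hS : ∀ s, C (Φ.op s (((Φ.op 1 : End ℂ X) - lam • (1 : End ℂ X)) v)) =
        C (Φ.op (s + 1) v) - lam • C (Φ.op s v) := fun s => by
      simp [Φ.op_add_apply]
    have hvan : Vanishes fun s => C (Φ.op s (((Φ.op 1 : End ℂ X) - lam • (1 : End ℂ X)) v)) := by
      have h1 : Tendsto (fun s => C (Φ.op (s + 1) v)) atTop (𝓝 0) :=
        Tendsto.comp (g := fun s => C (Φ.op s v)) hv
          (tendsto_atTop_mono (fun s => le_self_add) tendsto_id)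
      have h2 := h1.sub (Tendsto.const_smul hv lam)
      simp only [smul_zero, sub_zero] at h2
      exact h2.congr fun s => (hS s).symm
    have hstep : ∀ s, C (Φ.op (s + 1) v) = lam • C (Φ.op s v) := fun s => by
      rw [← sub_eq_zero, ← hS]
      exact ih hn hvan s
    have hpow : ∀ k : ℕ, C (Φ.op (t + k) v) = lam ^ k • C (Φ.op t v) := fun k => by
      induction k with
      | zero => simp
      | succ k ihk => rw [Nat.cast_succ, ← add_assoc, hstep, ihk, smul_smul, pow_succ']
    have hlim : Tendsto (fun k : ℕ => C (Φ.op (t + k) v)) atTop (𝓝 0) :=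
      Tendsto.comp (g := fun s => C (Φ.op s v)) hv 
        (tendsto_atTop_mono (fun k => le_add_self) tendsto_natCast_atTop_atTop)
    by_contra hne
    obtain ⟨i, hi⟩ := hp.separating_of_T1 _ hne
    have h1 : Tendsto (fun k : ℕ => p i (C (Φ.op (t + k) v))) atTop (𝓝 0) :=
      ((hp.continuous_seminorm i).tendsto' _ _ (map_zero _)).comp hlim
    have h2 : p i (C (Φ.op t v)) ≤ 0 := ge_of_tendsto h1 (.of_forall fun k => by
      rw [hpow, map_smul_eq_mul, norm_pow]
      exact le_mul_of_one_le_left (apply_nonneg _ _) (one_le_pow₀ hlam))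
    exact hi (le_antisymm h2 (apply_nonneg _ _))

/-- If the products `(μ_m - A) ⋯ (μ_1 - A)` with `e^{μ_j} = λ`, `|λ| ≥ 1`, only annihilate
unobservable vectors, then the unstable subspace of `Φ 1` is unobservable. -/
theorem IsGenerator.unstableSubspace_le_unobservableSubspace [CompleteSpace X]
    (h : IsGenerator A Φ)
    (hdom : ∀ x, Φ.op 1 x ∈ A.domain) (hcomp : IsCompactOperator (Φ.op 1))
    (hb : ∀ (v₀ : X) (lam : ℂ) (μ : List ℂ), 1 ≤ ‖lam‖ → (∀ z ∈ μ, Complex.exp z = lam) →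
      ProductAnnihilates A μ v₀ → v₀ ∈ unobservableSubspace Φ C) :
    unstableSubspace (Φ.op 1) ≤ unobservableSubspace Φ C := by
  have hfin := finiteDimensional_unstableSubspace hcomp
  refine iSup₂_le fun lam hlam v hv => ?_
  have : FiniteDimensional ℂ (maxGenEigenspace (Φ.op 1 : End ℂ X) lam) :=
    Submodule.finiteDimensional_of_le (maxGenEigenspace_le_unstableSubspace _ hlam)
  obtain ⟨l, hl, hlv⟩ := h.exists_productAnnihilates hdom
    (norm_pos_iff.1 (one_pos.trans_le hlam)) hv
  exact hb v lam l hlam hl hlv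

/-- A continuous nonnegative function of time that is halved after a time `N`, up to an error that
tends to `0`, tends to `0`. -/
theorem tendsto_zero_of_le_half {a : ℝ≥0 → ℝ} (ha : Continuous a) (ha0 : ∀ t, 0 ≤ a t)
    {N : ℝ≥0} (hN : 0 < N)
    (h : ∀ ε > 0, ∀ᶠ t in atTop, a (t + N) ≤ 1 / 2 * a t + ε) : Tendsto a atTop (𝓝 0) := by
  rw [Metric.tendsto_atTop]
  intro δ hδ
  obtain ⟨T, hT⟩ := eventually_atTop.1 (h (δ / 4) (by positivity))
  obtain ⟨b, hb⟩ := (isCompact_Icc (a := T) (b := T + N)).exists_bound_of_continuousOn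
    ha.continuousOn
  have hiter : ∀ (k : ℕ), ∀ t ∈ Icc T (T + N), a (t + k * N) ≤ (1 / 2) ^ k * b + δ / 2 :=
    fun k t ht => by
      induction k with
      | zero =>
        have := (le_abs_self _).trans (hb t ht)
        simp only [Nat.cast_zero, zero_mul, add_zero, pow_zero, one_mul]
        linarith
      | succ k ih =>
        have h1 := hT (t + k * N) (ht.1.trans le_self_add)
        have e : t + (k + 1 : ℕ) * N = t + k * N + N := by push_cast; ring
        rw [e, pow_succ]
        linarith
  have hlim : Tendsto (fun k : ℕ => ((1 : ℝ) / 2) ^ k * b) atTop (𝓝 0) := by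
    simpa using (tendsto_pow_atTop_nhds_zero_of_lt_one (by norm_num : (0 : ℝ) ≤ 1 / 2)
      (by norm_num)).mul_const b
  obtain ⟨k₀, hk₀⟩ := eventually_atTop.1 (hlim.eventually_lt_const (half_pos hδ))
  refine ⟨T + k₀ * N, fun s hs => ?_⟩
  -- write `s = t + k N` with `t` in `[T, T + N]` and `k₀ ≤ k`
  set k : ℕ := ⌊(s - T) / N⌋₊ with hk
  have hTs : T ≤ s := le_self_add.trans hs
  have h1 : k * N ≤ s - T := by
    rw [← le_div_iff₀ hN]
    exact Nat.floor_le zero_le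
  have h2 : s - T < (k + 1) * N := by
    rw [← div_lt_iff₀ hN]
    exact Nat.lt_floor_add_one _
  have h3 : k₀ ≤ k := by
    refine Nat.le_floor ?_
    rw [le_div_iff₀ hN]
    exact le_tsub_of_add_le_left hs
  have h4 : s = (s - k * N) + k * N :=
    (tsub_add_cancel_of_le (h1.trans tsub_le_self)).symm
  have h5 : s - k * N ∈ Icc T (T + N) := by
    refine ⟨le_tsub_of_add_le_left ?_, ?_⟩
    · rw [add_comm]
      exact (add_le_add_right h1 T).trans_eq (add_tsub_cancel_of_le hTs)
    · rw [tsub_le_iff_right]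
      have := tsub_lt_iff_left hTs |>.1 h2
      calc s ≤ T + (k + 1) * N := this.le
        _ = T + N + k * N := by ring
  have h6 := hiter k _ h5
  rw [← h4] at h6
  rw [Real.dist_eq, sub_zero, abs_of_nonneg (ha0 s)]
  linarith [hk₀ k h3]

/-- If the unstable subspace of the compact operator `Φ 1` is unobservable, then vanishing inputs
have vanishing outputs: modulo that subspace, a power of `Φ 1` is a contraction. -/
theorem IsGenerator.isVIVO_cauchyRelation [CompleteSpace X] [FrechetSpace Y]
    (h : IsGenerator A Φ)
    (hcomp : IsCompactOperator (Φ.op 1))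
    (hV : unstableSubspace (Φ.op 1) ≤ unobservableSubspace Φ C) :
    IsVIVO (cauchyRelation A B C D) := by
  rintro u y ⟨-, -, x, hx, hxA, hxy⟩ hu
  dsimp only at hxA hxy
  obtain ⟨n, hn, hhalf⟩ := exists_norm_mk_pow_le_half hcomp
  have hfin := finiteDimensional_unstableSubspace hcomp
  set V := unstableSubspace (Φ.op 1) with hVdef
  have hcl : IsClosed (V : Set X) := V.closed_of_finiteDimensional
  have hxd : ∀ t, HasTimeDeriv x (timeDeriv x t) t := fun t => hx.hasTimeDeriv 0 t
  have hxc : Continuous x := continuous_iff_continuousAt.2 fun t => (hxd t).continuousAt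
  choose hdom hderiv using hxA
  obtain ⟨K, hK0, hK⟩ := Φ.exists_norm_op_le n
  have hBu : Tendsto (fun t => ‖B (u t)‖) atTop (𝓝 0) := by
    have h1 : Tendsto (fun t => B (u t)) atTop (𝓝 0) :=
      (B.continuous.tendsto' _ _ B.map_zero).comp hu
    simpa using h1.norm
  have hnpos : (0 : ℝ≥0) < n := by exact_mod_cast hn
  have hlim : Tendsto (fun t => ‖V.mkQ (x t)‖) atTop (𝓝 0) := by
    refine tendsto_zero_of_le_half (N := n) (V.mkQL.continuous.comp hxc).norm
      (fun _ => norm_nonneg _) hnpos fun ε hε => ?_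
    have hε' : 0 < ε / (K * n) := by positivity
    obtain ⟨T, hT⟩ := eventually_atTop.1 (hBu.eventually_le_const hε')
    filter_upwards [eventually_ge_atTop T] with t ht
    have h1 := h.norm_sub_op_le hxd (fun s => A.mem_graph ⟨x s, hdom s⟩)
      (le_self_add : t ≤ t + n) (ε := ε / (K * n)) (K := K)
      (fun s hs => by
        rw [hderiv, add_sub_cancel_left]
        exact hT s (ht.trans hs.1)) (by simpa using hK)
    rw [add_tsub_cancel_left, NNReal.coe_add, add_sub_cancel_left] at h1
    have h2 : K * (ε / (K * n)) * ((n : ℝ≥0) : ℝ) = ε := by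
      have : ((n : ℝ≥0) : ℝ) ≠ 0 := by positivity
      simp only [NNReal.coe_natCast] at this ⊢
      field_simp
    rw [h2] at h1
    have h3 : V.mkQ (x (t + n)) = V.mkQ ((Φ.op 1 ^ n) (x t)) +
        V.mkQ (x (t + n) - Φ.op n (x t)) := by
      rw [← map_add, Φ.op_nat_mul, add_sub_cancel]
    rw [h3]
    exact (norm_add_le _ _).trans (add_le_add (hhalf _)
      ((Submodule.Quotient.norm_mk_le V _).trans h1))
  have hq : Tendsto (fun t => V.mkQ (x t)) atTop (𝓝 0) := tendsto_zero_iff_norm_tendsto_zero.2 hlim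
  -- the output only depends on the class of the state modulo `V`
  let C' : (X ⧸ V) →L[ℂ] Y := V.liftQL C fun v hv => by
    simpa [Φ.op_zero_apply] using mem_unobservableSubspace.1 (hV hv) 0
  have hC' : Tendsto (fun t => C (x t)) atTop (𝓝 0) :=
    (C'.continuous.tendsto' _ _ C'.map_zero).comp hq
  have hD : Tendsto (fun t => D (u t)) atTop (𝓝 0) :=
    (D.continuous.tendsto' _ _ D.map_zero).comp hu
  have h1 := hC'.add hD
  rw [add_zero] at h1
  exact h1.congr fun t => (hxy t).symm

end Stability

end

theorem mainTheorem5 {X U Y : Type*}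
    [NormedAddCommGroup X] [NormedSpace ℂ X] [CompleteSpace X]
    [AddCommGroup U] [Module ℂ U] [UniformSpace U] [FrechetSpace U]
    [AddCommGroup Y] [Module ℂ Y] [UniformSpace Y] [FrechetSpace Y]
    (A : X →ₗ.[ℂ] X) (hA : IsSectorial A) (hAc : HasCompactResolvents A)
    (B : U →L[ℂ] X) (C : X →L[ℂ] Y) (D : U →L[ℂ] Y) :
    (∃ Φ : C0Semigroup X, IsGenerator A Φ) ∧
      ∀ Φ : C0Semigroup X, IsGenerator A Φ →
        IsCompactOperator (Φ.op 1) ∧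
          List.TFAE
            [IsStable (cauchyRelation A B C D),
              ∀ (v₀ : X) (lam : ℂ) (μ : List ℂ), 1 ≤ ‖lam‖ → (∀ z ∈ μ, Complex.exp z = lam) →
                ProductAnnihilates A μ v₀ → v₀ ∈ unobservableSubspace Φ C,
              IsVIVO (cauchyRelation A B C D),
              IsSmoothlyVIVO (cauchyRelation A B C D)] := by
  have := FrechetSpace.continuousSMul_real (E := U)
  have := FrechetSpace.continuousSMul_real (E := Y)
  obtain ⟨Ψ, hΨ, z, R, L, hR, hRL⟩ := hA.exists_isGenerator
  refine ⟨⟨Ψ, hΨ⟩, fun Φ hΦ => ?_⟩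
  have hop : Φ.op 1 = R.comp L := by rw [hΦ.op_eq hΨ hA.1, hRL]
  have hcomp : IsCompactOperator (Φ.op 1) := by
    rw [hop]
    exact (hAc.2 z R hR).comp_clm L
  have hdom : ∀ x, Φ.op 1 x ∈ A.domain := fun x => by
    rw [hop]
    exact (hR.1 (L x)).1
  refine ⟨hcomp, ?_⟩
  tfae_have 1 → 2 := fun hs v lam μ hlam hμ hv => by
    obtain ⟨n, hn⟩ := (Module.End.mem_maxGenEigenspace _ _ _).1
      (hΦ.mem_maxGenEigenspace_of_productAnnihilates hμ hv)
    exact mem_unobservableSubspace.2 (output_eq_zero_of_vanishes hlam n hn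
      (hs _ (hΦ.zero_orbit_mem_cauchyRelation hv)))
  tfae_have 2 → 3 := fun hb =>
    hΦ.isVIVO_cauchyRelation hcomp (hΦ.unstableSubspace_le_unobservableSubspace hdom hcomp hb)
  tfae_have 3 → 4 := fun hv => hv.isSmoothlyVIVO fun _ _ => timeDeriv_mem_cauchyRelation hR
  tfae_have 4 → 1 := fun hv y hy => hv 0 y hy vanishesSmoothly_zero 0
  tfae_finish
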